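/- **Influence games.** An *influence graph* $(G,w,f)$ consists of a loopless directed graph $G=(V,E)$ with $V$ finite, edge weights $w:E\to\mathbb N$ and vertex labels $f:V\to\mathbb N$. For $X\subseteq V$ put $F_0(X)=X$ and $$F_{i}(X)=F_{i-1}(X)\cup\Big\{v\in V \;\Big|\; \sum_{u\in F_{i-1}(X),\,(u,v)\in E} w(u,v)\ge f(v)\Big\}\quad(i\ge 1),$$ and let $F(X)=\bigcup_{i\ge 0}F_i(X)$. An *influence game* $(G,w,f,q,N)$ has in addition a quota $q\in\{0,\dots,|V|+1\}$ and a set of players $N\subseteq V$. A team $X\subseteq N$ is winning, $X\in\mathcal W$, if $|F(X)|\ge q$, and losing, $X\in\mathcal L$, otherwise. An *unweighted influence game with minimum influence* is an influence game $\Gamma=(G,1_V,q,N)$ on an undirected simple graph $G$ (each edge taken in both directions) in which all edge weights and all labels are $1$. It is given by $q$, the characteristic vector of $N$ and the adjacency matrix of $G$, where $V=\{0,\dots,n-1\}$. **Theorem.** For unweighted influence games with minimum influence $\Gamma=(G,1_V,q,N)$, the following can be computed, respectively decided, in (deterministic) polynomial time: 1. Length: $\min\{|X| : X\in\mathcal W\}$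 (or the answer that $\mathcal W=\emptyset$); 2. Width: $\max\{|X| : X\in\mathcal L\}$ (or the answer that $\mathcal L=\emptyset$); 3. IsProper: whether $N\setminus X\in\mathcal L$ for every $X\in\mathcal W$; 4. IsStrong: whether $N\setminus X\in\mathcal W$ for every $X\in\mathcal L$; 5. IsDecisive: whether, for every $X\subseteq N$, $X\in\mathcal W$ if and only if $N\setminus X\in\mathcal L$. -/

import Mathlib

/-! Simple games, influence games, and a string encoding of unweighted, undirected
influence games with minimum influence. -/

namespace InfluenceSpread

/-- A simple game `(N, W)`: a finite set `N` of players and a monotonic family `W` of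
subsets of `N`, the winning coalitions. -/
structure SimpleGame (V : Type*) where
  players : Finset V
  winning : Finset (Finset V)
  subset_players : ∀ X ∈ winning, X ⊆ players
  monotonic : ∀ X ∈ winning, ∀ Z, Z ⊆ players → X ⊆ Z → Z ∈ winning

namespace SimpleGame

variable {V : Type*} [DecidableEq V] (Γ : SimpleGame V)

/-- The losing coalitions: the subsets of `N` that are not winning. -/
def losing : Finset (Finset V) := Γ.players.powerset \ Γ.winning

/-- The minimum size of a winning coalition; it is undefined, `none`, if there is none. -/
def length : Option ℕ :=
  if h : Γ.winning.Nonempty then some ((Γ.winning.image Finset.card).min' (h.image _)) else none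

/-- The maximum size of a losing coalition; it is undefined, `none`, if there is none. -/
def width : Option ℕ :=
  if h : Γ.losing.Nonempty then some ((Γ.losing.image Finset.card).max' (h.image _)) else none

def IsProper : Prop := ∀ X ∈ Γ.winning, Γ.players \ X ∈ Γ.losing

def IsStrong : Prop := ∀ X ∈ Γ.losing, Γ.players \ X ∈ Γ.winning

def IsDecisive : Prop := ∀ X, X ⊆ Γ.players → (X ∈ Γ.winning ↔ Γ.players \ X ∈ Γ.losing)

end SimpleGame

/-- An influence graph `(G, w, f)`: a loopless directed graph with edge weights (only the
values of `weight` on edges matter) and vertex labels. -/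
structure InfluenceGraph (V : Type*) where
  Edge : V → V → Prop
  loopless : ∀ v, ¬ Edge v v
  weight : V → V → ℕ
  label : V → ℕ

namespace InfluenceGraph

variable {V : Type*} [Fintype V] [DecidableEq V] (G : InfluenceGraph V)

open scoped Classical in
/-- One round of activation. -/
noncomputable def next (A : Finset V) : Finset V :=
  A ∪ Finset.univ.filter (fun v => G.label v ≤ ∑ u ∈ A with G.Edge u v, G.weight u v)

/-- `F_i(X)`, the set of vertices activated after `i` rounds. -/
noncomputable def stage (X : Finset V) : ℕ → Finset V
  | 0 => X
  | i + 1 => G.next (stage X i)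

open scoped Classical in
/-- `F(X)`, the spread of influence of `X`: the vertices activated in some round. -/
noncomputable def spread (X : Finset V) : Finset V :=
  Finset.univ.filter (fun v => ∃ i, v ∈ G.stage X i)

theorem next_mono {A B : Finset V} (h : A ⊆ B) : G.next A ⊆ G.next B := by
  classical
  intro v hv
  simp only [next, Finset.mem_union, Finset.mem_filter, Finset.mem_univ, true_and] at hv ⊢
  rcases hv with hv | hv
  · exact Or.inl (h hv)
  · exact Or.inr (hv.trans (Finset.sum_le_sum_of_subset (Finset.filter_subset_filter _ h)))

theorem stage_mono {X Y : Finset V} (h : X ⊆ Y) (i : ℕ) : G.stage X i ⊆ G.stage Y i := by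
  induction i with
  | zero => exact h
  | succ i ih => exact G.next_mono ih

theorem spread_mono {X Y : Finset V} (h : X ⊆ Y) : G.spread X ⊆ G.spread Y := by
  intro v hv
  simp only [spread, Finset.mem_filter, Finset.mem_univ, true_and] at hv ⊢
  obtain ⟨i, hi⟩ := hv
  exact ⟨i, G.stage_mono h i hi⟩

end InfluenceGraph

/-- An influence game `(G, w, f, q, N)` with quota `0 ≤ q ≤ |V| + 1` and players `N ⊆ V`. -/
structure InfluenceGame (V : Type*) [Fintype V] extends InfluenceGraph V where
  quota : ℕ
  quota_le : quota ≤ Fintype.card V + 1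
  players : Finset V

namespace InfluenceGame

variable {V : Type*} [Fintype V] [DecidableEq V]

/-- The simple game of an influence game: a team `X ⊆ N` is successful if and only if
`|F(X)| ≥ q`. -/
noncomputable def toSimpleGame (Γ : InfluenceGame V) : SimpleGame V where
  players := Γ.players
  winning := {X ∈ Γ.players.powerset | Γ.quota ≤ (Γ.spread X).card}
  subset_players X hX := by
    simp only [Finset.mem_filter, Finset.mem_powerset] at hX
    exact hX.1
  monotonic X hX Z hZ hXZ := by
    simp only [Finset.mem_filter, Finset.mem_powerset] at hX ⊢
    exact ⟨hZ, hX.2.trans (Finset.card_le_card (Γ.spread_mono hXZ))⟩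

end InfluenceGame

/-- The data `(G, q, N)` of an unweighted influence game `(G, 1_V, q, N)` with minimum
influence on an undirected graph `G` with vertices `0, …, n - 1`. -/
structure MinInfluenceGame where
  n : ℕ
  graph : SimpleGraph (Fin n)
  quota : ℕ
  quota_le : quota ≤ n + 1
  players : Finset (Fin n)

namespace MinInfluenceGame

/-- The influence game `(G, 1_V, q, N)`: every edge has weight `1` in both directions and
every vertex has label `1`. -/
def toInfluenceGame (Γ : MinInfluenceGame) : InfluenceGame (Fin Γ.n) where
  Edge := Γ.graph.Adj
  loopless v := Γ.graph.loopless.irrefl v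
  weight _ _ := 1
  label _ := 1
  quota := Γ.quota
  quota_le := by simpa using Γ.quota_le
  players := Γ.players

noncomputable def simpleGame (Γ : MinInfluenceGame) : SimpleGame (Fin Γ.n) :=
  Γ.toInfluenceGame.toSimpleGame

open scoped Classical in
/-- The description of a game as a list of binary words: the quota in unary (it is at most
`n + 1`, so this is polynomially equivalent to binary), the
characteristic vector of the set of players, and the rows of the adjacency matrix. -/
noncomputable def words (Γ : MinInfluenceGame) : List (List Bool) :=
  List.replicate Γ.quota true ::
    (List.finRange Γ.n).map (fun i => decide (i ∈ Γ.players)) ::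
      (List.finRange Γ.n).map
        (fun i => (List.finRange Γ.n).map (fun j => decide (Γ.graph.Adj i j)))

end MinInfluenceGame

/-- A list of binary words as one string, where `none` marks the end of a word. -/
def joinWords (l : List (List Bool)) : List (Option Bool) :=
  l.flatMap (fun w => w.map some ++ [none])

/-- The string that describes a game to a machine. -/
noncomputable def MinInfluenceGame.encode (Γ : MinInfluenceGame) : List (Option Bool) :=
  joinWords Γ.words

/-- Output format for a number that may be undefined. -/
def encodeOptionNat : Option ℕ → List Bool
  | none => [false]
  | some k => true :: Computability.unaryEncodeNat k

theorem joinWords_injective : Function.Injective joinWords := by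
  have key : ∀ (v w : List Bool) (s t : List (Option Bool)),
      v.map some ++ none :: s = w.map some ++ none :: t → v = w ∧ s = t := by
    intro v
    induction v with
    | nil => intro w s t h; cases w <;> simp_all
    | cons a v ih =>
      intro w s t h
      cases w with
      | nil => simp at h
      | cons b w =>
        simp only [List.map_cons, List.cons_append, List.cons.injEq, Option.some.injEq] at h
        obtain ⟨h1, h2⟩ := ih w s t h.2
        exact ⟨by rw [h.1, h1], h2⟩
  intro l
  induction l with
  | nil => intro m h; cases m <;> simp_all [joinWords]
  | cons v l ih =>
    intro m h
    cases m with
    | nil => simp [joinWords] at h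
    | cons w m =>
      simp only [joinWords, List.flatMap_cons, List.append_assoc, List.singleton_append] at h
      obtain ⟨h1, h2⟩ := key _ _ _ _ h
      rw [h1, ih h2]

/-- Different games have different descriptions. -/
theorem MinInfluenceGame.encode_injective : Function.Injective MinInfluenceGame.encode := by
  classical
  rintro ⟨n, G, q, hq, N⟩ ⟨n', G', q', hq', N'⟩ h
  have h' := joinWords_injective h
  simp only [MinInfluenceGame.words, List.cons.injEq] at h'
  obtain ⟨h1, h2, h3⟩ := h'
  have e1 : q = q' := by simpa using congrArg List.length h1
  have e2 : n = n' := by simpa using congrArg List.length h2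
  subst e1 e2
  have e3 : N = N' := by
    ext i
    have h4 := List.map_inj_left.1 h2 i (List.mem_finRange i)
    simpa using h4
  have e4 : G = G' := by
    ext i j
    simp only [List.map_inj_left, List.mem_finRange, true_implies] at h3
    simpa using h3 i j
  subst e3 e4
  rfl

theorem encodeOptionNat_injective : Function.Injective encodeOptionNat := by
  have key : ∀ k, (Computability.unaryEncodeNat k).length = k := by
    intro k
    induction k with
    | zero => rfl
    | succ k ih => simp [Computability.unaryEncodeNat, ih]
  rintro (_ | a) (_ | b) h
  · rfl
  · simp [encodeOptionNat] at h
  · simp [encodeOptionNat] at h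
  · simp only [encodeOptionNat, List.cons.injEq, true_and] at h
    rw [← key a, h, key b]

/-- `f` is computable in polynomial time by a multi-stack Turing machine, with respect to
the string encodings `ea` of inputs and `eb` of outputs. -/
def PolyTime {α β αΓ βΓ : Type} (ea : α → List αΓ) (eb : β → List βΓ) (f : α → β) : Prop :=
  Nonempty (Turing.TM2ComputableInPolyTime ea eb f)

open scoped Classical in
/-- The decision problem `P`, on instances encoded by `ea`, belongs to the class P. -/
def InP {α αΓ : Type} (ea : α → List αΓ) (P : α → Prop) : Prop :=
  PolyTime ea Computability.encodeBool (fun a => decide (P a))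

end InfluenceSpread

/-!
# Influence games with minimum influence: problems in polynomial time

All labels are `1`, so a team activates exactly the connected components that it meets
(`MinInfluenceGame.mem_spread`). A team `X` therefore matters only through the number `j t` of its
members in each component, and these numbers can be prescribed freely between `0` and the number
of players in the component (`exists_teamCount_eq`). The size of `X` is the sum of the `j t`, the
spread of `X` is the sum of the sizes of the components with `j t ≠ 0`, and the spread of `N \ X` is
the sum of the sizes of the components that have more than `j t` players. Which pairs
`(|X|, |F(X)|)` and `(|F(X)|, |F(N \ X)|)` occur (`Profile` and `SplitProfile`) is thus a problem
of subset sums with numbers that are at most `n`, solved by dynamic programming over the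
components. Length, width, properness and strength can be read off these relations, and a game is
decisive if and only if it is proper and strong.

The rest shows that this algorithm runs in polynomial time on a multi-stack machine, without
programming it by hand.

* Structured programs (`Prog`), with a big-step semantics that counts time (`Prog.Exec`), compile
  to machines (`Prog.polyTime_of_exec`).
* On top of them, two stacks form a tape that carries the input word and finitely many tracks, each
  of which marks a set of positions (`TExec`).
* Formulas (`Fml`) speak about sets of positions of the word. Besides propositional logic, they
  have an operator that iterates a definable map of sets as many times as the word has positions.
  A formula is evaluated in polynomial time, and the number of positions that satisfy it is computed
  in polynomial time (`polyTime_of_fml`): the exponent grows with the nesting of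
  iterations, which is fixed.
* Numbers below the length of the word are represented by positions. The relations and functions
  given by formulas are closed under quantifiers, counting, sums, products and the recursion of
  dynamic programming (`Definable`, `DefFun`, `Definable.chain`, `Definable.sum_choice`). Since the
  word that describes a game with `n` vertices has more than `(n + 1) ^ 2` letters, pairs of numbers
  up to `n` can be coded by positions, which is all that the algorithm needs (`definable_pair`).
-/

/-! ### Structured programs for multi-stack machines -/

namespace InfluenceSpread

open Turing

/-- A structured program over the stacks `k : K` with alphabets `Γ k` and the finite memory `σ`. -/
inductive Prog {K : Type} (Γ : K → Type) (σ : Type)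
  | push (k : K) (f : σ → Γ k)
  | pop (k : K) (f : σ → Option (Γ k) → σ)
  | load (f : σ → σ)
  | seq (p q : Prog Γ σ)
  | ite (c : σ → Bool) (p q : Prog Γ σ)
  | loop (c : σ → Bool) (p : Prog Γ σ)

namespace Prog

variable {K : Type} {Γ : K → Type} {σ : Type}

/-- The control points of a program. A branching and a loop have the extra point `none`, at which
the condition is tested. -/
def Label : Prog Γ σ → Type
  | push _ _ | pop _ _ | load _ => Unit
  | seq p q => p.Label ⊕ q.Label
  | ite _ p q => Option (p.Label ⊕ q.Label)
  | loop _ p => Option p.Label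

noncomputable instance fintypeLabel : (p : Prog Γ σ) → Fintype p.Label
  | push _ _ | pop _ _ | load _ => inferInstanceAs (Fintype Unit)
  | seq p q =>
    haveI := fintypeLabel p
    haveI := fintypeLabel q
    inferInstanceAs (Fintype (p.Label ⊕ q.Label))
  | ite _ p q =>
    haveI := fintypeLabel p
    haveI := fintypeLabel q
    inferInstanceAs (Fintype (Option (p.Label ⊕ q.Label)))
  | loop _ p =>
    haveI := fintypeLabel p
    inferInstanceAs (Fintype (Option p.Label))

/-- The control point at which a program starts. -/
def start : (p : Prog Γ σ) → p.Label
  | push _ _ | pop _ _ | load _ => ()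
  | seq p _ => Sum.inl p.start
  | ite _ _ _ | loop _ _ => none

/-- The machine code of a program whose control points are embedded by `e` into the labels of a
machine, and which jumps to the label `x` at its end. -/
def code {Λ : Type} : (p : Prog Γ σ) → (p.Label → Λ) → Λ → p.Label → TM2.Stmt Γ Λ σ
  | push k f, _, x, _ => .push k f (.goto fun _ => x)
  | pop k f, _, x, _ => .pop k f (.goto fun _ => x)
  | load f, _, x, _ => .load f (.goto fun _ => x)
  | seq p q, e, x, l =>
    match l with
    | Sum.inl l => p.code (fun l => e (Sum.inl l)) (e (Sum.inr q.start)) l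
    | Sum.inr l => q.code (fun l => e (Sum.inr l)) x l
  | ite c p q, e, x, l =>
    match l with
    | none => .branch c (.goto fun _ => e (some (Sum.inl p.start)))
        (.goto fun _ => e (some (Sum.inr q.start)))
    | some (Sum.inl l) => p.code (fun l => e (some (Sum.inl l))) x l
    | some (Sum.inr l) => q.code (fun l => e (some (Sum.inr l))) x l
  | loop c p, e, x, l =>
    match l with
    | none => .branch c (.goto fun _ => e (some p.start)) (.goto fun _ => x)
    | some l => p.code (fun l => e (some l)) (e none) l

/-- `Exec p v S t v' S'`: the program `p`, started with memory `v` and stacks `S`, ends within time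
`t` with memory `v'` and stacks `S'`. The number `t` is only an upper bound for the running time, so
that bounds can be weakened. -/
inductive Exec [DecidableEq K] :
    Prog Γ σ → σ → (∀ k, List (Γ k)) → ℕ → σ → (∀ k, List (Γ k)) → Prop
  | push (k f v S) : Exec (push k f) v S 1 v (Function.update S k (f v :: S k))
  | pop (k f v S) : Exec (pop k f) v S 1 (f v (S k).head?) (Function.update S k (S k).tail)
  | load (f v S) : Exec (load f) v S 1 (f v) S
  | seq {p q v S t v' S' t' v'' S''} : Exec p v S t v' S' → Exec q v' S' t' v'' S'' →
      Exec (seq p q) v S (t + t') v'' S''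
  | ite_true {c p q v S t v' S'} : c v = true → Exec p v S t v' S' →
      Exec (ite c p q) v S (t + 1) v' S'
  | ite_false {c p q v S t v' S'} : c v = false → Exec q v S t v' S' →
      Exec (ite c p q) v S (t + 1) v' S'
  | loop_false {c p v S} : c v = false → Exec (loop c p) v S 1 v S
  | loop_true {c p v S t v' S' t' v'' S''} : c v = true → Exec p v S t v' S' →
      Exec (loop c p) v' S' t' v'' S'' → Exec (loop c p) v S (t + t' + 1) v'' S''
  | mono {p v S t v' S' t'} : Exec p v S t v' S' → t ≤ t' → Exec p v S t' v' S'

/-- Any machine that contains the code of a program performs the executions of the program. -/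
theorem Exec.steps [DecidableEq K] {Λ : Type} {M : Λ → TM2.Stmt Γ Λ σ} {p : Prog Γ σ} {v S t v' S'}
    (h : Exec p v S t v' S') :
    ∀ (e : p.Label → Λ) (x : Λ), (∀ l, M (e l) = p.code e x l) →
      ∃ n ≤ t, (flip bind (TM2.step M))^[n] (some ⟨some (e p.start), v, S⟩) =
        some ⟨some x, v', S'⟩ := by
  induction h with
  | push | pop | load =>
    intro e x hM
    refine ⟨1, le_rfl, ?_⟩
    have := hM ()
    simp [flip, start, this, code]
  | @seq p q _ _ _ _ _ _ _ _ _ _ ih ih' =>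
    intro e x hM
    obtain ⟨n, hn, h⟩ := ih (fun l => e (Sum.inl l)) (e (Sum.inr q.start))
      (fun l => hM (Sum.inl l))
    obtain ⟨n', hn', h'⟩ := ih' (fun l => e (Sum.inr l)) x (fun l => hM (Sum.inr l))
    refine ⟨n' + n, by omega, ?_⟩
    rw [Function.iterate_add_apply]
    exact (congrArg _ h).trans h'
  | @ite_true c p q _ _ _ _ _ hc _ ih =>
    intro e x hM
    obtain ⟨n, hn, h⟩ := ih (fun l => e (some (Sum.inl l))) x (fun l => hM (some (Sum.inl l)))
    refine ⟨n + 1, by omega, ?_⟩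
    rw [Function.iterate_succ_apply, ← h]
    have := hM none
    simp [flip, this, code, start, hc]
  | @ite_false c p q _ _ _ _ _ hc _ ih =>
    intro e x hM
    obtain ⟨n, hn, h⟩ := ih (fun l => e (some (Sum.inr l))) x (fun l => hM (some (Sum.inr l)))
    refine ⟨n + 1, by omega, ?_⟩
    rw [Function.iterate_succ_apply, ← h]
    have := hM none
    simp [flip, this, code, start, hc]
  | loop_false hc =>
    intro e x hM
    refine ⟨1, le_rfl, ?_⟩
    have := hM none
    simp [flip, this, code, start, hc]
  | @loop_true c p v S _ _ _ _ _ _ hc _ _ ih ih' =>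
    intro e x hM
    obtain ⟨n, hn, h⟩ := ih (fun l => e (some l)) (e none) (fun l => hM (some l))
    obtain ⟨n', hn', h'⟩ := ih' e x hM
    refine ⟨n' + (n + 1), by omega, ?_⟩
    have h0 : (flip bind (TM2.step M)) (some ⟨some (e (start (loop c p))), v, S⟩) =
        some ⟨some (e (some p.start)), v, S⟩ := by
      have := hM none
      simp [flip, this, code, start, hc]
    rw [Function.iterate_add_apply, Function.iterate_succ_apply, h0]
    exact (congrArg _ h).trans h'
  | mono _ ht ih =>
    intro e x hM
    obtain ⟨n, hn, h⟩ := ih e x hM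
    exact ⟨n, hn.trans ht, h⟩

/-- The machine that runs a program and halts. -/
noncomputable def toFinTM2 [DecidableEq K] [Fintype K] [Fintype σ] (p : Prog Γ σ) (k₀ k₁ : K)
    [Fintype (Γ k₀)] (v₀ : σ) : FinTM2 where
  K := K
  k₀ := k₀
  k₁ := k₁
  Γ := Γ
  Λ := Option p.Label
  main := some p.start
  σ := σ
  initialState := v₀
  m
    | some l => p.code some none l
    | none => .halt

theorem dite_eq_update [DecidableEq K] (k₀ : K) (s : List (Γ k₀)) :
    (fun k => if h : k = k₀ then by rw [h]; exact s else []) =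
      Function.update (fun k => ([] : List (Γ k))) k₀ s := by
  funext k
  by_cases hk : k = k₀
  · subst hk
    simp
  · simp [hk]

/-- A program that turns the encoding of every `a`, given on the stack `k₀`, in polynomial time
into that of `f a` on the stack `k₁`, and leaves the other stacks and the memory clean. -/
theorem polyTime_of_exec [DecidableEq K] [Fintype K] [Fintype σ] (p : Prog Γ σ) (k₀ k₁ : K)
    [Fintype (Γ k₀)] (v₀ : σ) {α β : Type} {ea : α → List (Γ k₀)} {eb : β → List (Γ k₁)}
    {f : α → β} (time : Polynomial ℕ)
    (h : ∀ a, Exec p v₀ (Function.update (fun _ => []) k₀ (ea a)) (time.eval (ea a).length)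
      v₀ (Function.update (fun _ => []) k₁ (eb (f a)))) : PolyTime ea eb f := by
  have hinit : ∀ s, initList (p.toFinTM2 k₀ k₁ v₀) s =
      ⟨some (some p.start), v₀, Function.update (fun _ => []) k₀ s⟩ := by
    intro s
    unfold initList
    congr 1
    exact dite_eq_update k₀ s
  have hhalt : ∀ s, haltList (p.toFinTM2 k₀ k₁ v₀) s =
      ⟨none, v₀, Function.update (fun _ => []) k₁ s⟩ := by
    intro s
    unfold haltList
    congr 1
    exact dite_eq_update k₁ s
  refine ⟨{
    tm := p.toFinTM2 k₀ k₁ v₀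
    inputAlphabet := Equiv.refl _
    outputAlphabet := Equiv.refl _
    time := time + 1
    outputsFun := fun a => ?_ }⟩
  have hs := (h a).steps (M := (p.toFinTM2 k₀ k₁ v₀).m) some none (fun l => rfl)
  -- One more step halts the machine at the label `none`.
  refine { steps := hs.choose + 1, evals_in_steps := ?_, steps_le_m := ?_ }
  · have h1 := hs.choose_spec.2
    rw [Nat.add_comm, Function.iterate_add_apply]
    have e1 : (Equiv.refl (Γ k₀)).invFun = id := rfl
    have e2 : (Equiv.refl (Γ k₁)).invFun = id := rfl
    have e3 : List.map (Equiv.refl (Γ k₀)).invFun (ea a) = ea a := by rw [e1, List.map_id]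
    have e4 : List.map (Equiv.refl (Γ k₁)).invFun (eb (f a)) = eb (f a) := by
      rw [e2, List.map_id]
    erw [e3, e4, hinit, Option.map_some, hhalt]
    exact congrArg _ h1
  · have := hs.choose_spec.1
    simp only [Polynomial.eval_add, Polynomial.eval_one]
    omega

end Prog

end InfluenceSpread

/-! ### A tape with finitely many tracks -/

namespace InfluenceSpread

section Tape

open scoped Classical

variable {S : Type} {D : ℕ}

/-- The stacks of the tape machine: input, the two halves of the tape, and output. -/
inductive TapeStack
  | inp
  | left
  | right
  | out
  deriving DecidableEq

instance : Fintype TapeStack where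
  elems := {.inp, .left, .right, .out}
  complete := by intro k; cases k <;> decide

/-- A cell of the tape: a letter of the input word, and a mark on each of the `D` main tracks and
the `D` auxiliary tracks. -/
abbrev Cell (S : Type) (D : ℕ) : Type := Option S × (Fin D → Bool) × (Fin D → Bool)

/-- The alphabets of the stacks of the tape machine. -/
@[reducible]
def TapeStack.alphabet (S : Type) (D : ℕ) : TapeStack → Type
  | inp => S
  | left => Cell S D
  | right => Cell S D
  | out => Bool

/-- The memory of the tape machine: two bits, of which the first is the result of the last test,
and the cell under the head. -/
abbrev Mem (S : Type) (D : ℕ) : Type := (Bool × Bool) × Option (Cell S D)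

/-- Programs of the tape machine. -/
abbrev TapeProg (S : Type) (D : ℕ) : Type := Prog (TapeStack.alphabet S D) (Mem S D)

/-- The stacks of the tape machine with given contents. -/
def contents (i : List S) (l r : List (Cell S D)) (o : List Bool) :
    ∀ k, List (TapeStack.alphabet S D k)
  | .inp => i
  | .left => l
  | .right => r
  | .out => o

@[simp]
theorem update_contents_inp (i i' : List S) (l r : List (Cell S D)) (o : List Bool) :
    Function.update (contents i l r o) .inp i' = contents i' l r o := by
  funext k; cases k <;> rfl

@[simp]
theorem update_contents_left (i : List S) (l r l' : List (Cell S D)) (o : List Bool) :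
    Function.update (contents i l r o) .left l' = contents i l' r o := by
  funext k; cases k <;> rfl

@[simp]
theorem update_contents_right (i : List S) (l r r' : List (Cell S D)) (o : List Bool) :
    Function.update (contents i l r o) .right r' = contents i l r' o := by
  funext k; cases k <;> rfl

@[simp]
theorem update_contents_out (i : List S) (l r : List (Cell S D)) (o o' : List Bool) :
    Function.update (contents i l r o) .out o' = contents i l r o' := by
  funext k; cases k <;> rfl

namespace TapeProg

open Prog

theorem exec_push_left (q c i) (l r : List (Cell S D)) (o : List Bool) :
    Exec (push .left (fun v : Mem S D => v.2.getD (none, fun _ => false, fun _ => false)))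
      (q, some c) (contents i l r o) 1 (q, some c) (contents i (c :: l) r o) := by
  have := Exec.push (Γ := TapeStack.alphabet S D) .left
    (fun v : Mem S D => v.2.getD (none, fun _ => false, fun _ => false))
    (q, some c) (contents i l r o)
  simpa [contents] using this

theorem exec_push_right (q c i) (l r : List (Cell S D)) (o : List Bool) :
    Exec (push .right (fun v : Mem S D => v.2.getD (none, fun _ => false, fun _ => false)))
      (q, some c) (contents i l r o) 1 (q, some c) (contents i l (c :: r) o) := by
  have := Exec.push (Γ := TapeStack.alphabet S D) .right
    (fun v : Mem S D => v.2.getD (none, fun _ => false, fun _ => false))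
    (q, some c) (contents i l r o)
  simpa [contents] using this

theorem exec_pop_left (q x i) (l r : List (Cell S D)) (o : List Bool) :
    Exec (pop .left (fun v c => (v.1, c))) ((q, x) : Mem S D)
      (contents i l r o) 1 (q, l.head?) (contents i l.tail r o) := by
  have := Exec.pop (Γ := TapeStack.alphabet S D) .left
    (fun (v : Mem S D) c => (v.1, c)) (q, x) (contents i l r o)
  simpa [contents] using this

theorem exec_pop_right (q x i) (l r : List (Cell S D)) (o : List Bool) :
    Exec (pop .right (fun v c => (v.1, c))) ((q, x) : Mem S D)
      (contents i l r o) 1 (q, r.head?) (contents i l r.tail o) := by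
  have := Exec.pop (Γ := TapeStack.alphabet S D) .right
    (fun (v : Mem S D) c => (v.1, c)) (q, x) (contents i l r o)
  simpa [contents] using this

/-- Move the head back to the left end of the tape. The default cell of `getD` is never written,
since the loop runs only while the memory holds a cell. -/
def rewind : TapeProg S D :=
  seq (pop .left fun v c => (v.1, c))
    (loop (fun v => v.2.isSome)
      (seq (push .right fun v => v.2.getD (none, fun _ => false, fun _ => false))
        (pop .left fun v c => (v.1, c))))

theorem rewind_exec (q x i o) (l r : List (Cell S D)) :
    Exec rewind (q, x) (contents i l r o) (3 * l.length + 2) (q, none)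
      (contents i [] (l.reverse ++ r) o) := by
  have key : ∀ (l r : List (Cell S D)), Exec
      (loop (fun v => v.2.isSome)
        (seq (push .right fun v : Mem S D => v.2.getD (none, fun _ => false, fun _ => false))
        (pop .left fun v c => (v.1, c)))) (q, l.head?) (contents i l.tail r o) (3 * l.length + 1)
      (q, none) (contents i [] (l.reverse ++ r) o) := by
    intro l
    induction l with
    | nil => intro r; exact (Exec.loop_false rfl).mono (by simp)
    | cons c l ih =>
      intro r
      refine (Exec.loop_true rfl ((exec_push_right ..).seq (exec_pop_left ..)) ?_).mono
        (t := 1 + 1 + (3 * l.length + 1) + 1) (by simp; omega)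
      simpa using ih (c :: r)
  exact ((exec_pop_left ..).seq (key l r)).mono (by omega)

/-- One scan of the tape by a finite automaton that may rewrite the cells; afterwards the head is
back at the left end. -/
def pass (δ : Bool × Bool → Cell S D → (Bool × Bool) × Cell S D) : TapeProg S D :=
  seq (pop .right fun v c => (v.1, c))
    (seq (loop (fun v => v.2.isSome)
      (seq (load fun v => (v.2.map (δ v.1)).elim v fun r => (r.1, some r.2))
        (seq (push .left fun v => v.2.getD (none, fun _ => false, fun _ => false))
          (pop .right fun v c => (v.1, c)))))
      rewind)

/-- The automaton is in the state `st i` before it reads the cell `i`, and rewrites the cell `c i` as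
`c' i`. -/
theorem pass_exec (δ : Bool × Bool → Cell S D → (Bool × Bool) × Cell S D) (st : ℕ → Bool × Bool)
    (c c' : ℕ → Cell S D) (n : ℕ) (h : ∀ i < n, δ (st i) (c i) = (st (i + 1), c' i)) (x i o) :
    Exec (pass δ) (st 0, x) (contents i [] ((List.range n).map c) o) (7 * n + 4) (st n, none)
      (contents i [] ((List.range n).map c') o) := by
  have key : ∀ (m s : ℕ) (l : List (Cell S D)), s + m = n → Exec
      (loop (fun v => v.2.isSome)
        (seq (load fun v => (v.2.map (δ v.1)).elim v fun r => (r.1, some r.2))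
          (seq (push .left fun v : Mem S D => v.2.getD (none, fun _ => false, fun _ => false))
            (pop .right fun v c => (v.1, c)))))
      (st s, ((List.range' s m).map c).head?) (contents i l ((List.range' s m).map c).tail o)
      (4 * m + 1) (st n, none) (contents i (((List.range' s m).map c').reverse ++ l) [] o) := by
    intro m
    induction m with
    | zero =>
      intro s l hs
      obtain rfl : s = n := by omega
      exact (Exec.loop_false rfl).mono (by simp)
    | succ m ih =>
      intro s l hs
      simp only [List.range'_succ, List.map_cons, List.head?_cons, List.tail_cons,
        List.reverse_cons, List.append_assoc, List.singleton_append]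
      refine (Exec.loop_true rfl ((Exec.load ..).seq ((?_ : Exec _ _ _ 1
        (st (s + 1), some (c' s)) (contents i (c' s :: l) _ o)).seq
        (exec_pop_right ..))) (ih (s + 1) (c' s :: l) (by omega))).mono (by omega)
      simp only [Option.map_some, Option.elim_some, h s (by omega)]
      exact exec_push_left ..
  have h2 := rewind_exec (st n) none i o (((List.range' 0 n).map c').reverse ++ []) []
  have h1 := key n 0 [] (by omega)
  simp only [← List.range_eq_range'] at h1 h2
  simp only [List.append_nil, List.reverse_reverse, List.length_reverse, List.length_map,
    List.length_range] at h1 h2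
  exact Exec.mono (Exec.seq (exec_pop_right ..) (Exec.seq h1 h2)) (by omega)

end TapeProg

/-! ### Scans of a tape that represents sets -/

/-- The mark of a cell on a main track. -/
def Cell.main (c : Cell S D) (k : ℕ) : Bool := if h : k < D then c.2.1 ⟨k, h⟩ else false

/-- The mark of a cell on an auxiliary track. -/
def Cell.aux (c : Cell S D) (k : ℕ) : Bool := if h : k < D then c.2.2 ⟨k, h⟩ else false

/-- Change the mark of a cell on a main track. -/
def Cell.setMain (c : Cell S D) (k : ℕ) (b : Bool) : Cell S D :=
  (c.1, fun j => if j.val = k then b else c.2.1 j, c.2.2)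

/-- Change the mark of a cell on an auxiliary track. -/
def Cell.setAux (c : Cell S D) (k : ℕ) (b : Bool) : Cell S D :=
  (c.1, c.2.1, fun j => if j.val = k then b else c.2.2 j)

/-- The cell at position `i` of the tape that carries the word `w`, whose `k`-th main track marks
the set `α k` and whose `k`-th auxiliary track marks the set `β k`. -/
noncomputable def cell (D : ℕ) (w : List S) (α β : ℕ → Set ℕ) (i : ℕ) : Cell S D :=
  (w[i]?, fun k => decide (i ∈ α k), fun k => decide (i ∈ β k))

theorem main_cell {w : List S} {α β : ℕ → Set ℕ} {i k : ℕ} (hk : k < D) :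
    (cell D w α β i).main k = decide (i ∈ α k) := by
  simp [Cell.main, cell, hk]

theorem aux_cell {w : List S} {α β : ℕ → Set ℕ} {i k : ℕ} (hk : k < D) :
    (cell D w α β i).aux k = decide (i ∈ β k) := by
  simp [Cell.aux, cell, hk]

theorem setMain_cell {w : List S} {α β : ℕ → Set ℕ} {i k : ℕ} {b : Bool} {X : Set ℕ}
    (hb : b = decide (i ∈ X)) :
    (cell D w α β i).setMain k b = cell D w (Function.update α k X) β i := by
  subst hb
  simp only [Cell.setMain, cell, Prod.mk.injEq, true_and, and_true]
  funext j
  by_cases h : j.val = k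
  · simp [h]
  · simp [h]

theorem setAux_cell {w : List S} {α β : ℕ → Set ℕ} {i k : ℕ} {b : Bool} {X : Set ℕ}
    (hb : b = decide (i ∈ X)) :
    (cell D w α β i).setAux k b = cell D w α (Function.update β k X) i := by
  subst hb
  simp only [Cell.setAux, cell, Prod.mk.injEq, true_and]
  funext j
  by_cases h : j.val = k
  · simp [h]
  · simp [h]

/-- `TExec w p q α β o t q' α' β' o'`: the program `p` turns the tape with word `w` and tracks
`α`, `β` into that with tracks `α'`, `β'`, the output `o` into `o'` and the memory bits `q` into
`q'`, within time `t`. -/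
def TExec (w : List S) (p : TapeProg S D) (q : Bool × Bool) (α β : ℕ → Set ℕ) (o : List Bool)
    (t : ℕ) (q' : Bool × Bool) (α' β' : ℕ → Set ℕ) (o' : List Bool) : Prop :=
  Prog.Exec p (q, none) (contents [] [] ((List.range w.length).map (cell D w α β)) o) t
    (q', none) (contents [] [] ((List.range w.length).map (cell D w α' β')) o')

namespace TExec

variable {w : List S} {p p' : TapeProg S D} {q q' q'' : Bool × Bool}
  {α β α' β' α'' β'' : ℕ → Set ℕ} {o o' o'' : List Bool} {t t' : ℕ}

theorem mono (h : TExec w p q α β o t q' α' β' o') (ht : t ≤ t') :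
    TExec w p q α β o t' q' α' β' o' :=
  Prog.Exec.mono h ht

theorem seq (h : TExec w p q α β o t q' α' β' o') (h' : TExec w p' q' α' β' o' t' q'' α'' β'' o'') :
    TExec w (p.seq p') q α β o (t + t') q'' α'' β'' o'' :=
  Prog.Exec.seq h h'

theorem load (f : Bool × Bool → Bool × Bool) :
    TExec (D := D) w (.load fun v => (f v.1, v.2)) q α β o 1 (f q) α β o :=
  Prog.Exec.load (fun v : Mem S D => (f v.1, v.2)) (q, none) _

theorem pass {δ : Bool × Bool → Cell S D → (Bool × Bool) × Cell S D} (st : ℕ → Bool × Bool)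
    (h : ∀ i < w.length, δ (st i) (cell D w α β i) = (st (i + 1), cell D w α' β' i)) :
    TExec w (TapeProg.pass δ) (st 0) α β o (7 * w.length + 4) (st w.length) α' β' o :=
  TapeProg.pass_exec δ st _ _ _ h none [] o

/-- Only the part of a set below the length of the tape is represented. -/
theorem congr_right (h : TExec w p q α β o t q' α' β' o')
    (hα : ∀ k, ∀ i < w.length, i ∈ α' k ↔ i ∈ α'' k)
    (hβ : ∀ k, ∀ i < w.length, i ∈ β' k ↔ i ∈ β'' k) : TExec w p q α β o t q' α'' β'' o' := by
  have : (List.range w.length).map (cell D w α' β') =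
      (List.range w.length).map (cell D w α'' β'') := by
    refine List.map_congr_left fun i hi => ?_
    rw [List.mem_range] at hi
    simp [cell, hα _ i hi, hβ _ i hi]
  unfold TExec at h ⊢
  rwa [this] at h

end TExec

/-- Search the tape from left to right for a cell that satisfies `g`, where the first argument of
`g` tells whether an earlier cell satisfies `m`. -/
def TapeProg.search (m : Cell S D → Bool) (g : Bool → Cell S D → Bool) : TapeProg S D :=
  .seq (.load fun v => ((false, false), v.2))
    (.seq (TapeProg.pass fun q c => ((q.1 || g q.2 c, q.2 || m c), c))
      (.load fun v => ((v.1.1, false), v.2)))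

theorem TExec.search (w : List S) (m : Cell S D → Bool) (g : Bool → Cell S D → Bool) (q α β o)
    {P : Prop} (hP : P ↔ ∃ i < w.length, g (decide (∃ j < i, m (cell D w α β j) = true))
      (cell D w α β i) = true) :
    TExec w (TapeProg.search m g) q α β o (9 * (w.length + 1)) (decide P, false) α β o := by
  rw [decide_eq_decide.2 hP]
  have h := TExec.pass (w := w) (α := α) (β := β) (α' := α) (β' := β) (o := o)
    (δ := fun q c => ((q.1 || g q.2 c, q.2 || m c), c))
    (fun n => (decide (∃ i < n, g (decide (∃ j < i, m (cell D w α β j) = true))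
        (cell D w α β i) = true), decide (∃ j < n, m (cell D w α β j) = true))) (by
    intro i _
    simp only [Nat.lt_succ_iff_lt_or_eq, or_and_right, exists_or, exists_eq_left]
    simp)
  simp only [Nat.not_lt_zero, false_and, exists_false, decide_false] at h
  exact ((TExec.load fun _ => (false, false)).seq
    (h.seq (TExec.load fun v => (v.1, false)))).mono (by omega)

/-- Run `p` with the track `k` marking the positions of the tape one after the other. The first
scan marks the position `0`, with the bit `q.2` telling whether the first cell has been passed. The
scan after each run of `p` shifts the mark by one position, with `q.2` holding the mark of the
previous cell; the loop ends when the mark leaves the tape. -/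
def TapeProg.forTrack (k : ℕ) (p : TapeProg S D) : TapeProg S D :=
  .seq (.load fun v => ((false, false), v.2))
    (.seq (TapeProg.pass fun q c => ((true, true), c.setMain k (!q.2)))
      (.loop (fun v => v.1.1)
        (.seq p
          (.seq (.load fun v => ((v.1.1, false), v.2))
            (.seq (TapeProg.pass fun q c => ((q.1, c.main k), c.setMain k q.2))
              (.load fun v => ((!v.1.2, v.1.1), v.2)))))))

/-- The tracks and the output before the `i`-th run of `p` are `α i`, `β i` and `o i`. -/
theorem TExec.forTrack {w : List S} {p : TapeProg S D} {k T : ℕ} (hk : k < D)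
    (α β : ℕ → ℕ → Set ℕ) (o : ℕ → List Bool) (h0 : α w.length k = ∅)
    (h : ∀ i < w.length, ∀ q, ∃ q', TExec w p q (Function.update (α i) k {i}) (β i) (o i) T
      q' (Function.update (α (i + 1)) k {i}) (β (i + 1)) (o (i + 1))) (q) :
    ∃ q', TExec w (TapeProg.forTrack k p) q (α 0) (β 0) (o 0)
      ((w.length + 1) * (T + 16 * (w.length + 1))) q' (α w.length) (β w.length) (o w.length) := by
  -- The singleton of the length of the word marks no cell.
  have hend : ∀ (p : TapeProg S D) q α₀ β₀ o₀ t q',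
      TExec w p q α₀ β₀ o₀ t q' (Function.update (α w.length) k {w.length}) (β w.length)
        (o w.length) → TExec w p q α₀ β₀ o₀ t q' (α w.length) (β w.length) (o w.length) := by
    intro p q α₀ β₀ o₀ t q' h
    refine h.congr_right (fun j i hi => ?_) (fun _ _ _ => Iff.rfl)
    by_cases hj : j = k
    · subst hj
      simp [h0, hi.ne]
    · simp [hj]
  have hshift : ∀ i < w.length, ∀ α β o b, TExec (D := D) w
      (TapeProg.pass fun q c => ((q.1, c.main k), c.setMain k q.2)) (b, false)
      (Function.update α k {i}) β o (7 * w.length + 4) (b, decide (w.length = i + 1))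
      (Function.update α k {i + 1}) β o := by
    intro i hi α β o b
    refine TExec.pass (fun n => (b, decide (n = i + 1))) (fun n hn => ?_)
    simp only [main_cell hk, Function.update_self, Set.mem_singleton_iff, Nat.add_right_cancel_iff]
    rw [setMain_cell (X := {i + 1}) (by simp), Function.update_idem]
  have hfirst : ∀ α β o, TExec (D := D) w
      (TapeProg.pass fun q c => ((true, true), c.setMain k (!q.2))) (false, false)
      α β o (7 * w.length + 4) (decide (w.length ≠ 0), decide (w.length ≠ 0))
      (Function.update α k {0}) β o := by
    intro α β o
    refine TExec.pass (fun n => (decide (n ≠ 0), decide (n ≠ 0))) (fun n hn => ?_)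
    simp only [ne_eq, Nat.add_eq_zero_iff, one_ne_zero, and_false, not_false_eq_true, decide_true]
    rw [setMain_cell (X := {0}) (by simp)]
  -- The loop, entered before the `i`-th run of `p`, with `m` runs to go.
  have key : ∀ m i, i + m = w.length → ∀ b, ∃ q', TExec w
      (.loop (fun v => v.1.1)
        (.seq p
          (.seq (.load fun v => ((v.1.1, false), v.2))
            (.seq (TapeProg.pass fun q c => ((q.1, c.main k), c.setMain k q.2))
              (.load fun v => ((!v.1.2, v.1.1), v.2))))))
      (decide (i ≠ w.length), b) (Function.update (α i) k {i}) (β i) (o i)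
      (m * (T + 7 * w.length + 7) + 1) q' (α w.length) (β w.length) (o w.length) := by
    intro m
    induction m with
    | zero =>
      intro i hi b
      obtain rfl : i = w.length := by omega
      exact ⟨_, hend _ _ _ _ _ _ _ ((Prog.Exec.loop_false (by simp)).mono (by simp))⟩
    | succ m ih =>
      intro i hi b
      obtain ⟨q1, h1⟩ := h i (by omega) (decide (i ≠ w.length), b)
      obtain ⟨q2, h2⟩ := ih (i + 1) (by omega) q1.1
      refine ⟨q2, ?_⟩
      have h3 := h1.seq ((TExec.load fun v => (v.1, false)).seq
        ((hshift i (by omega) (α (i + 1)) (β (i + 1)) (o (i + 1)) q1.1).seq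
          (TExec.load fun v => (!v.2, v.1))))
      have h4 : (!decide (w.length = i + 1)) = decide (i + 1 ≠ w.length) := by
        simp [eq_comm]
      simp only [h4] at h3
      refine Prog.Exec.mono (Prog.Exec.loop_true (by simp; omega) h3 h2) ?_
      ring_nf
      omega
  obtain ⟨q', h'⟩ := key w.length 0 (by omega) (decide (w.length ≠ 0))
  refine ⟨q', TExec.mono (TExec.seq (TExec.load fun _ => (false, false))
    (TExec.seq (hfirst (α 0) (β 0) (o 0)) ?_)) (t := 1 + ((7 * w.length + 4) +
      (w.length * (T + 7 * w.length + 7) + 1))) ?_⟩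
  · have : decide (w.length ≠ 0) = decide (0 ≠ w.length) := by simp [eq_comm]
    rw [this] at h' ⊢
    exact h'
  · nlinarith

end Tape

end InfluenceSpread

/-! ### A logic of bounded iteration -/

namespace InfluenceSpread

section Formula

open scoped Classical

variable {S : Type} {D : ℕ}

/-- Formulas about subsets of the set of positions of a word. Variables are de Bruijn levels. A
number is represented by the singleton that contains it.

* `mem X Y` says that `X` and `Y` intersect;
* `lt X Y` says that some element of `X` is less than some element of `Y`;
* `letter a X` says that the letter `a` occurs at some position in `X`;
* `nand φ ψ` says that `φ` and `ψ` are not both true;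
* `iter φ ψ` says that `ψ` holds for the last of the sets `A 0 = ∅`,
  `A (t + 1) = {x | φ (A t) t x}`, where `t` and `x` range over the positions of the word. -/
inductive Fml (S : Type)
  | mem (X Y : ℕ)
  | lt (X Y : ℕ)
  | letter (a : S) (X : ℕ)
  | nand (φ ψ : Fml S)
  | iter (φ ψ : Fml S)

namespace Fml

/-- The truth value of a formula with variables below `d`, about the word `w`, under the
assignment `α`. -/
def eval (w : List S) : Fml S → ℕ → (ℕ → Set ℕ) → Prop
  | mem X Y, _, α => ∃ i < w.length, i ∈ α X ∧ i ∈ α Y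
  | lt X Y, _, α => ∃ i < w.length, (∃ j < i, j ∈ α X) ∧ i ∈ α Y
  | letter a X, _, α => ∃ i < w.length, i ∈ α X ∧ w[i]? = some a
  | nand φ ψ, d, α => ¬ (φ.eval w d α ∧ ψ.eval w d α)
  | iter φ ψ, d, α => ψ.eval w (d + 1) (Function.update α d (Nat.rec ∅ (fun t A =>
      {x | x < w.length ∧ φ.eval w (d + 3) (Function.update (Function.update
        (Function.update α d A) (d + 1) {t}) (d + 2) {x})}) w.length))

/-- The sets defined by the iteration of a formula. -/
def stage (w : List S) (φ : Fml S) (d : ℕ) (α : ℕ → Set ℕ) (t : ℕ) : Set ℕ :=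
  Nat.rec ∅ (fun t A => {x | x < w.length ∧ φ.eval w (d + 3) (Function.update (Function.update
        (Function.update α d A) (d + 1) {t}) (d + 2) {x})}) t

/-- The number of tracks that the evaluation of a formula with variables below `d` needs. -/
def tracks : Fml S → ℕ → ℕ
  | mem X Y, _ | lt X Y, _ => max (X + 1) (Y + 1)
  | letter _ X, _ => X + 1
  | nand φ ψ, d => max (φ.tracks d) (ψ.tracks d)
  | iter φ ψ, d => max (d + 3) (max (φ.tracks (d + 3)) (ψ.tracks (d + 1)))

/-- The program that evaluates a formula. The next set of an iteration is collected on the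
auxiliary track `d` and moved to the main track `d` when it is complete. -/
noncomputable def compile : Fml S → ℕ → TapeProg S D
  | mem X Y, _ => TapeProg.search (fun _ => false) (fun _ c => c.main X && c.main Y)
  | lt X Y, _ => TapeProg.search (fun c => c.main X) (fun b c => b && c.main Y)
  | letter a X, _ => TapeProg.search (fun _ => false)
      (fun _ c => c.main X && decide (c.1 = some a))
  | nand φ ψ, d => .seq (φ.compile d) (.ite (fun v => v.1.1)
      (.seq (ψ.compile d) (.load fun v => ((!v.1.1, false), v.2)))
      (.load fun v => ((true, false), v.2)))
  | iter φ ψ, d =>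
      .seq (TapeProg.forTrack (d + 1)
        (.seq
          (TapeProg.forTrack (d + 2) (.seq (φ.compile (d + 3))
            (TapeProg.pass fun q c => (q, if c.main (d + 2) then c.setAux d q.1 else c))))
          (TapeProg.pass fun q c => (q, (c.setMain d (c.aux d)).setAux d false))))
        (.seq (ψ.compile (d + 1)) (TapeProg.pass fun q c => (q, c.setMain d false)))

/-- A bound for the time of the evaluation of a formula on words of length `X`. -/
noncomputable def time : Fml S → Polynomial ℕ
  | mem _ _ | lt _ _ | letter _ _ => 9 * (.X + 1)
  | nand φ ψ => φ.time + ψ.time + 2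
  | iter φ ψ => (.X + 1) * ((.X + 1) * (φ.time + 7 * .X + 4 + 16 * (.X + 1)) + 7 * .X + 4 +
      16 * (.X + 1)) + ψ.time + 7 * .X + 4

/-- The evaluation of a formula with variables below `d` uses the tracks from `d` on as scratch space:
they are empty before and after it. -/
theorem compile_exec (w : List S) (φ : Fml S) : ∀ (d : ℕ) (α β : ℕ → Set ℕ) (o q),
    φ.tracks d ≤ D → (∀ k ≥ d, α k = ∅) → (∀ k ≥ d, β k = ∅) →
    TExec (D := D) w (φ.compile d) q α β o (φ.time.eval w.length)
      (decide (φ.eval w d α), false) α β o := by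
  induction φ with
  | mem X Y =>
    intro d α β o q hD _ _
    simp only [tracks, max_le_iff] at hD
    refine (TExec.search w _ _ q α β o ?_).mono (by simp [time])
    simp [eval, main_cell hD.1, main_cell hD.2]
  | lt X Y =>
    intro d α β o q hD _ _
    simp only [tracks, max_le_iff] at hD
    refine (TExec.search w _ _ q α β o ?_).mono (by simp [time])
    simp [eval, main_cell hD.1, main_cell hD.2]
  | letter a X =>
    intro d α β o q hD _ _
    simp only [tracks] at hD
    refine (TExec.search w _ _ q α β o ?_).mono (by simp [time])
    simp only [eval, main_cell hD, Bool.and_eq_true, decide_eq_true_eq]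
    exact Iff.rfl
  | nand φ ψ ihφ ihψ =>
    intro d α β o q hD hα hβ
    simp only [tracks, max_le_iff] at hD
    have h1 := ihφ d α β o q hD.1 hα hβ
    by_cases h : φ.eval w d α
    · have h2 := ihψ d α β o (decide (φ.eval w d α), false) hD.2 hα hβ
      have h3 := Prog.Exec.seq h1 (Prog.Exec.ite_true (c := fun v : Mem S D => v.1.1)
        (q := .load fun v => ((true, false), v.2)) (by simp [h])
        (TExec.seq h2 (TExec.load fun v => (!v.1, false))))
      refine TExec.mono ?_ (t := φ.time.eval w.length + (ψ.time.eval w.length + 1 + 1))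
        (by simp [time]; omega)
      simpa [compile, eval, h, TExec] using h3
    · have h3 := Prog.Exec.seq h1 (Prog.Exec.ite_false (c := fun v : Mem S D => v.1.1)
        (p := .seq (ψ.compile d) (.load fun v => ((!v.1.1, false), v.2))) (by simp [h])
        (TExec.load fun _ => (true, false)))
      refine TExec.mono ?_ (t := φ.time.eval w.length + (1 + 1)) (by simp [time])
      simpa [compile, eval, h, TExec] using h3
  | iter φ ψ ihφ ihψ =>
    intro d α β o q hD hα hβ
    simp only [tracks, max_le_iff] at hD
    obtain ⟨hD, hDφ, hDψ⟩ := hD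
    set A := stage w φ d α with hA
    have hαd : Function.update α d (A 0) = α := Function.update_eq_self_iff.2 (hα d le_rfl).symm
    -- One round of the iteration collects the set `A (t + 1)` on the auxiliary track `d`.
    have inner : ∀ t q, ∃ q', TExec (D := D) w (TapeProg.forTrack (d + 2) (.seq (φ.compile (d + 3))
        (TapeProg.pass fun q c => (q, if c.main (d + 2) then c.setAux d q.1 else c)))) q
        (Function.update (Function.update α d (A t)) (d + 1) {t}) β o
        ((w.length + 1) * ((φ.time.eval w.length + (7 * w.length + 4)) + 16 * (w.length + 1))) q'
        (Function.update (Function.update α d (A t)) (d + 1) {t})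
        (Function.update β d (A (t + 1))) o := by
      intro t q
      -- The elements of `A (t + 1)` below `i` have been collected before the position `i` is tested.
      have hbody : ∀ i < w.length, ∀ q, ∃ q', TExec (D := D) w (.seq (φ.compile (d + 3))
          (TapeProg.pass fun q c => (q, if c.main (d + 2) then c.setAux d q.1 else c))) q
          (Function.update (Function.update (Function.update α d (A t)) (d + 1) {t}) (d + 2) {i})
          (Function.update β d {y | y < i ∧ y ∈ A (t + 1)}) o
          (φ.time.eval w.length + (7 * w.length + 4)) q'
          (Function.update (Function.update (Function.update α d (A t)) (d + 1) {t}) (d + 2) {i})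
          (Function.update β d {y | y < i + 1 ∧ y ∈ A (t + 1)}) o := by
        intro i hi q
        have h1 := ihφ (d + 3) (Function.update (Function.update (Function.update α d (A t))
          (d + 1) {t}) (d + 2) {i}) (Function.update β d {y | y < i ∧ y ∈ A (t + 1)}) o q hDφ
          (fun k hk => by
            rw [Function.update_of_ne (by omega), Function.update_of_ne (by omega),
              Function.update_of_ne (by omega), hα k (by omega)])
          (fun k hk => by rw [Function.update_of_ne (by omega), hβ k (by omega)])
        refine ⟨_, h1.seq (TExec.pass (fun _ => _) fun j hj => ?_)⟩
        have hm : decide (φ.eval w (d + 3) (Function.update (Function.update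
            (Function.update α d (A t)) (d + 1) {t}) (d + 2) {i})) = decide (i ∈ A (t + 1)) := by
          refine decide_eq_decide.2 (Iff.symm (Iff.trans (?_ : _ ↔ i < w.length ∧ _)
            (and_iff_right hi)))
          exact Iff.rfl
        rw [main_cell (by omega)]
        refine Prod.ext rfl ?_
        by_cases hji : j = i
        · subst hji
          simp only [Function.update_self, Set.mem_singleton_iff, decide_true, if_true]
          rw [hm, setAux_cell (X := {y | y < j + 1 ∧ y ∈ A (t + 1)}) (by simp),
            Function.update_idem]
        · simp only [Function.update_self, Set.mem_singleton_iff, hji, decide_false,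
            Bool.false_eq_true, if_false, cell]
          refine Prod.ext rfl (Prod.ext rfl (funext fun k => ?_))
          by_cases hk : (k : ℕ) = d
          · simp only [hk, Function.update_self, Set.mem_ofPred_eq]
            refine decide_eq_decide.2 (and_congr_left fun _ => ?_)
            omega
          · simp [hk]
      obtain ⟨q', h⟩ := TExec.forTrack (w := w) (D := D) (k := d + 2) (by omega)
        (fun _ => Function.update (Function.update α d (A t)) (d + 1) {t})
        (fun x => Function.update β d {y | y < x ∧ y ∈ A (t + 1)}) (fun _ => o)
        (by simp [hα]) hbody q
      refine ⟨q', ?_⟩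
      have e : Function.update β d {y | y < 0 ∧ y ∈ A (t + 1)} = β := by
        simp only [Nat.not_lt_zero, false_and, Set.ofPred_false]
        exact Function.update_eq_self_iff.2 (hβ d le_rfl).symm
      rw [e] at h
      refine h.congr_right (fun _ _ _ => Iff.rfl) fun k i hi => ?_
      by_cases hk : k = d
      · subst hk; simp [hi]
      · simp [hk]
    -- Each round ends by moving the new set to the main track `d`.
    obtain ⟨q1, outer⟩ := TExec.forTrack (w := w) (D := D) (k := d + 1) (by omega)
      (p := .seq (TapeProg.forTrack (d + 2) (.seq (φ.compile (d + 3))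
        (TapeProg.pass fun q c => (q, if c.main (d + 2) then c.setAux d q.1 else c))))
          (TapeProg.pass fun q c => (q, (c.setMain d (c.aux d)).setAux d false)))
      (T := (w.length + 1) * ((φ.time.eval w.length + (7 * w.length + 4)) + 16 * (w.length + 1)) +
        (7 * w.length + 4))
      (fun t => Function.update α d (A t)) (fun _ => β) (fun _ => o) (by simp [hα])
      (fun t ht q => by
        obtain ⟨q', h⟩ := inner t q
        refine ⟨q', h.seq (TExec.pass (fun _ => _) fun j hj => ?_)⟩
        refine Prod.ext rfl ?_
        change Cell.setAux (Cell.setMain _ _ _) _ _ = _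
        rw [aux_cell (by omega), Function.update_self, setMain_cell (X := A (t + 1)) rfl,
          setAux_cell (X := ∅) (by simp), Function.update_idem]
        congr 1
        · rw [Function.update_comm (by omega), Function.update_idem]
        · exact Function.update_eq_self_iff.2 (hβ d le_rfl).symm) q
    rw [hαd] at outer
    have h2 := ihψ (d + 1) (Function.update α d (A w.length)) β o q1 hDψ
      (fun k hk => by rw [Function.update_of_ne (by omega), hα k (by omega)])
      (fun k hk => hβ k (by omega))
    refine (outer.seq (h2.seq (TExec.pass (fun _ => _) fun j hj => ?_))).mono ?_
    · refine Prod.ext rfl ?_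
      change Cell.setMain _ _ _ = _
      rw [setMain_cell (X := ∅) (by simp), Function.update_idem,
        Function.update_eq_self_iff.2 (hα d le_rfl).symm]
    · simp only [time, Polynomial.eval_add, Polynomial.eval_mul, Polynomial.eval_X,
        Polynomial.eval_one, Polynomial.eval_ofNat]
      ring_nf
      exact le_rfl

end Fml

/-! ### Machines that evaluate formulas -/

/-- Copy the input to the tape. -/
def TapeProg.init : TapeProg S D :=
  .seq (.pop .inp fun v a => (v.1, a.map fun a => (some a, fun _ => false, fun _ => false)))
    (.seq (.loop (fun v => v.2.isSome)
      (.seq (.push .left fun v => v.2.getD (none, fun _ => false, fun _ => false))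
        (.pop .inp fun v a => (v.1, a.map fun a => (some a, fun _ => false, fun _ => false)))))
      TapeProg.rewind)

theorem TapeProg.init_exec (w : List S) :
    Prog.Exec (TapeProg.init (D := D)) ((false, false), none) (contents w [] [] [])
      (6 * w.length + 4) ((false, false), none)
      (contents [] [] ((List.range w.length).map (cell D w (fun _ => ∅) (fun _ => ∅))) []) := by
  set e : S → Cell S D := fun a => (some a, fun _ => false, fun _ => false) with he
  have hpop : ∀ (x) (w : List S) (l : List (Cell S D)), Prog.Exec (.pop .inp fun v a => (v.1, a.map e))
      (((false, false), x) : Mem S D) (contents w l [] []) 1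
      ((false, false), w.head?.map e) (contents w.tail l [] []) := by
    intro x w l
    have := Prog.Exec.pop (Γ := TapeStack.alphabet S D) .inp
      (fun (v : Mem S D) a => (v.1, a.map e)) ((false, false), x) (contents w l [] [])
    simpa [contents] using this
  have key : ∀ (w : List S) (l : List (Cell S D)), Prog.Exec
      (.loop (fun v : Mem S D => v.2.isSome)
        (.seq (.push .left fun v => v.2.getD (none, fun _ => false, fun _ => false))
          (.pop .inp fun v a => (v.1, a.map e))))
      ((false, false), w.head?.map e) (contents w.tail l [] []) (3 * w.length + 1)
      ((false, false), none) (contents [] ((w.map e).reverse ++ l) [] []) := by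
    intro w
    induction w with
    | nil => intro l; exact (Prog.Exec.loop_false rfl).mono (by simp)
    | cons a w ih =>
      intro l
      refine (Prog.Exec.loop_true rfl ((TapeProg.exec_push_left ..).seq (hpop ..)) ?_).mono
        (t := 1 + 1 + (3 * w.length + 1) + 1) (by simp; omega)
      simpa using ih (e a :: l)
  have htape : (List.range w.length).map (cell D w (fun _ => ∅) (fun _ => ∅)) = w.map e := by
    refine List.ext_getElem (by simp) fun i h _ => ?_
    have hi : i < w.length := by simpa using h
    simp [cell, he, hi]
  rw [htape]
  have h2 := TapeProg.rewind_exec (false, false) none [] [] ((w.map e).reverse ++ []) []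
  have h1 := key w []
  simp only [List.append_nil, List.reverse_reverse, List.length_reverse, List.length_map]
    at h1 h2
  exact ((hpop none w []).seq (h1.seq h2)).mono (by omega)

/-- Erase the tape and the memory, as the machine model demands at the end of a computation. -/
def TapeProg.clean : TapeProg S D :=
  .seq (.pop .right fun v c => (v.1, c))
    (.seq (.loop (fun v => v.2.isSome) (.pop .right fun v c => (v.1, c)))
      (.load fun _ => ((false, false), none)))

theorem TapeProg.clean_exec (q x o) (r : List (Cell S D)) :
    Prog.Exec TapeProg.clean (q, x) (contents [] [] r o) (2 * r.length + 3) ((false, false), none)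
      (contents [] [] [] o) := by
  have key : ∀ (r : List (Cell S D)), Prog.Exec
      (.loop (fun v => v.2.isSome) (.pop .right fun v c => (v.1, c)))
      ((q, r.head?) : Mem S D) (contents [] [] r.tail o) (2 * r.length + 1) (q, none)
      (contents [] [] [] o) := by
    intro r
    induction r with
    | nil => exact (Prog.Exec.loop_false rfl).mono (by simp)
    | cons c r ih =>
      exact (Prog.Exec.loop_true rfl (TapeProg.exec_pop_right ..) ih).mono (by simp; omega)
  exact ((TapeProg.exec_pop_right ..).seq ((key r).seq (Prog.Exec.load ..))).mono (by omega)

theorem TExec.push_out (w : List S) (q α β o b) :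
    TExec (D := D) w (.push .out fun _ => b) q α β o 1 q α β (b :: o) := by
  have := Prog.Exec.push (Γ := TapeStack.alphabet S D) .out (fun _ : Mem S D => b) (q, none)
    (contents [] [] ((List.range w.length).map (cell D w α β)) o)
  simpa [contents, TExec] using this

/-- The program that writes the number of those positions that satisfy `φ`, provided that `ψ` is
true. -/
noncomputable def TapeProg.output (φ ψ : Fml S) : TapeProg S D :=
  .seq (ψ.compile 0) (.ite (fun v => v.1.1)
    (.seq (TapeProg.forTrack 0 (.seq (φ.compile 1)
      (.ite (fun v => v.1.1) (.push .out fun _ => true) (.load fun v => (v.1, v.2)))))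
      (.push .out fun _ => true))
    (.push .out fun _ => false))

theorem encodeOptionNat_some (k : ℕ) :
    encodeOptionNat (some k) = true :: List.replicate k true := by
  have : ∀ k, Computability.unaryEncodeNat k = List.replicate k true := by
    intro k
    induction k with
    | zero => rfl
    | succ k ih => rw [Computability.unaryEncodeNat, ih, List.replicate_succ]
  rw [encodeOptionNat, this]

theorem TapeProg.output_exec (w : List S) (φ ψ : Fml S) (hφ : φ.tracks 1 ≤ D)
    (hψ : ψ.tracks 0 ≤ D) (hD : 0 < D) (q) :
    ∃ q', TExec (D := D) w (TapeProg.output φ ψ) q (fun _ => ∅) (fun _ => ∅) []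
      (ψ.time.eval w.length +
        ((w.length + 1) * ((φ.time.eval w.length + 2) + 16 * (w.length + 1)) + 2))
      q' (fun _ => ∅) (fun _ => ∅)
      (encodeOptionNat (if ψ.eval w 0 (fun _ => ∅) then some
        ((Finset.range w.length).filter fun x =>
          φ.eval w 1 (Function.update (fun _ => ∅) 0 {x})).card else none)) := by
  have h1 := ψ.compile_exec (D := D) w 0 (fun _ => ∅) (fun _ => ∅) [] q hψ (fun _ _ => rfl)
    (fun _ _ => rfl)
  by_cases h : ψ.eval w 0 (fun _ => ∅)
  · set c : ℕ → ℕ := fun i => ((Finset.range i).filter fun x =>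
          φ.eval w 1 (Function.update (fun _ => ∅) 0 {x})).card with hc
    obtain ⟨q', h2⟩ := TExec.forTrack (w := w) (D := D) (k := 0) hD
      (p := .seq (φ.compile 1)
        (.ite (fun v => v.1.1) (.push .out fun _ => true) (.load fun v => (v.1, v.2))))
      (T := φ.time.eval w.length + 2) (fun _ _ => ∅) (fun _ _ => ∅)
      (fun i => List.replicate (c i) true) rfl (fun i hi q => by
        have h3 := φ.compile_exec (D := D) w 1 (Function.update (fun _ => ∅) 0 {i}) (fun _ => ∅)
          (List.replicate (c i) true) q hφ
          (fun k hk => by rw [Function.update_of_ne (by omega)]) (fun _ _ => rfl)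
        by_cases hi : φ.eval w 1 (Function.update (fun _ => ∅) 0 {i})
        · have hci : c (i + 1) = c i + 1 := by
            simp [hc, Finset.range_add_one, Finset.filter_insert, hi]
          rw [hci]
          exact ⟨_, h3.seq (Prog.Exec.ite_true (by simp [hi]) (TExec.push_out ..))⟩
        · have hci : c (i + 1) = c i := by
            simp [hc, Finset.range_add_one, Finset.filter_insert, hi]
          rw [hci]
          exact ⟨_, h3.seq (Prog.Exec.ite_false (by simp [hi]) (TExec.load fun v => v))⟩)
      (decide (ψ.eval w 0 (fun _ => ∅)), false)
    refine ⟨q', ?_⟩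
    rw [if_pos h, encodeOptionNat_some]
    exact h1.seq (Prog.Exec.ite_true (by simp [h]) (h2.seq (TExec.push_out ..)))
  · refine ⟨(decide (ψ.eval w 0 (fun _ => ∅)), false), ?_⟩
    rw [if_neg h]
    exact (h1.seq (Prog.Exec.ite_false (by simp [h]) (TExec.push_out ..))).mono (by omega)

/-- Functions defined by formulas are computable in polynomial time. -/
theorem polyTime_of_fml [Fintype S] {ι : Type} {enc : ι → List S} {f : ι → Option ℕ} (φ ψ : Fml S)
    (h : ∀ a, f a = if ψ.eval (enc a) 0 (fun _ => ∅) then some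
        ((Finset.range (enc a).length).filter fun x =>
          φ.eval (enc a) 1 (Function.update (fun _ => ∅) 0 {x})).card else none) :
    PolyTime enc encodeOptionNat f := by
  -- The formula `φ` has the variable `0`, which takes a track.
  set D := max (max (φ.tracks 1) (ψ.tracks 0)) 1 with hD
  refine Prog.polyTime_of_exec (Γ := TapeStack.alphabet S D) (σ := Mem S D)
    (.seq TapeProg.init (.seq (TapeProg.output φ ψ) TapeProg.clean)) .inp .out
    ((false, false), none)
    (6 * .X + 4 + ((ψ.time + ((.X + 1) * ((φ.time + 2) + 16 * (.X + 1)) + 2)) + (2 * .X + 3)))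
    fun a => ?_
  have e1 : Function.update (β := fun k => List (TapeStack.alphabet S D k)) (fun _ => [])
      .inp (enc a) =
      contents (D := D) (enc a) [] [] [] := by
    funext k; cases k <;> rfl
  have e2 : Function.update (β := fun k => List (TapeStack.alphabet S D k)) (fun _ => [])
      .out (encodeOptionNat (f a)) =
      contents (S := S) (D := D) [] [] [] (encodeOptionNat (f a)) := by
    funext k; cases k <;> rfl
  obtain ⟨q', h2⟩ := TapeProg.output_exec (D := D) (enc a) φ ψ (by omega) (by omega) (by omega)
    (false, false)
  have h3 := TapeProg.clean_exec (D := D) q' none (encodeOptionNat (f a))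
    ((List.range (enc a).length).map (cell D (enc a) (fun _ => ∅) (fun _ => ∅)))
  rw [← h a] at h2
  rw [e1, e2]
  refine ((TapeProg.init_exec (enc a)).seq (Prog.Exec.seq h2 h3)).mono ?_
  simp

end Formula

end InfluenceSpread

/-! ### Definable relations and functions -/

namespace InfluenceSpread

section Definable

open scoped Classical

variable {S : Type} {T T' : Type}

namespace Fml

/-- Rename the variables of a formula. -/
def rename (ρ : ℕ → ℕ) : Fml S → Fml S
  | mem X Y => mem (ρ X) (ρ Y)
  | lt X Y => lt (ρ X) (ρ Y)
  | letter a X => letter a (ρ X)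
  | nand φ ψ => nand (φ.rename ρ) (ψ.rename ρ)
  | iter φ ψ => iter (φ.rename ρ) (ψ.rename ρ)

/-- A renaming may permute and identify the free variables, but has to map bound variables to
bound variables, whose levels start at `d` before and at `d'` after it. -/
theorem eval_rename (w : List S) (ρ : ℕ → ℕ) (φ : Fml S) : ∀ (d d' : ℕ) (α α' : ℕ → Set ℕ),
    (∀ k < d, ρ k < d') → (∀ j, ρ (d + j) = d' + j) → (∀ k, α' (ρ k) = α k) →
    ((φ.rename ρ).eval w d' α' ↔ φ.eval w d α) := by
  induction φ with
  | mem X Y => intro d d' α α' _ _ h; simp [rename, eval, h]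
  | lt X Y => intro d d' α α' _ _ h; simp [rename, eval, h]
  | letter a X => intro d d' α α' _ _ h; simp [rename, eval, h]
  | nand φ ψ ihφ ihψ =>
    intro d d' α α' h1 h2 h
    simp only [rename, eval, ihφ d d' α α' h1 h2 h, ihψ d d' α α' h1 h2 h]
  | iter φ ψ ihφ ihψ =>
    intro d d' α α' h1 h2 h
    have bind : ∀ m (α α' : ℕ → Set ℕ) X, (∀ k, α' (ρ k) = α k) →
        ∀ k, Function.update α' (d' + m) X (ρ k) = Function.update α (d + m) X k := by
      intro m α α' X h k
      by_cases hk : k = d + m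
      · subst hk
        simp [h2]
      · have : ρ k ≠ d' + m := by
          rcases lt_or_ge k d with hkd | hkd
          · have := h1 k hkd
            omega
          · obtain ⟨j, rfl⟩ := Nat.exists_eq_add_of_le hkd
            rw [h2]
            omega
        rw [Function.update_of_ne this, Function.update_of_ne hk, h]
    have low : ∀ m, ∀ k < d + m, ρ k < d' + m := by
      intro m k hk
      rcases lt_or_ge k d with hkd | hkd
      · have := h1 k hkd
        omega
      · obtain ⟨j, rfl⟩ := Nat.exists_eq_add_of_le hkd
        rw [h2]
        omega
    have high : ∀ m, ∀ j, ρ (d + m + j) = d' + m + j := by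
      intro m j
      rw [add_assoc, h2, add_assoc]
    have hstage : ∀ t, stage w (φ.rename ρ) d' α' t = stage w φ d α t := by
      intro t
      induction t with
      | zero => rfl
      | succ t ih =>
        change {x | _ ∧ _} = {x | _ ∧ _}
        ext x
        refine and_congr_right fun _ => ihφ (d + 3) (d' + 3) _ _ (low 3) (high 3) ?_
        have ih' : (Nat.rec ∅ (fun t A => {x | x < w.length ∧ (φ.rename ρ).eval w (d' + 3)
          (Function.update (Function.update (Function.update α' d' A) (d' + 1) {t}) (d' + 2)
            {x})}) t : Set ℕ) = stage w φ d α t := ih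
        rw [ih']
        exact bind 2 _ _ _ (bind 1 _ _ _ (bind 0 _ _ _ h))
    refine ihψ (d + 1) (d' + 1) _ _ (low 1) (high 1) ?_
    have ih' : (Nat.rec ∅ (fun t A => {x | x < w.length ∧ (φ.rename ρ).eval w (d' + 3)
      (Function.update (Function.update (Function.update α' d' A) (d' + 1) {t}) (d' + 2)
        {x})}) w.length : Set ℕ) = stage w φ d α w.length := hstage _
    rw [ih']
    exact bind 0 _ _ _ h

end Fml

/-- A context: a family of words, indexed by the parameters in `T` that are `valid`, and for each
of them an assignment of sets to the variables below `depth`. The other variables are empty, as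
`Fml.compile_exec` requires. -/
structure Ctx (S T : Type) where
  valid : T → Prop
  word : T → List S
  depth : ℕ
  env : T → ℕ → Set ℕ
  env_eq : ∀ t, ∀ k ≥ depth, env t k = ∅

namespace Ctx

/-- The number of positions of the word. -/
abbrev len (C : Ctx S T) (t : T) : ℕ := (C.word t).length

/-- Extend a context by a variable for a number less than the length of the word. -/
def pushNum (C : Ctx S T) : Ctx S (T × ℕ) where
  valid p := C.valid p.1 ∧ p.2 < C.len p.1
  word p := C.word p.1
  depth := C.depth + 1
  env p := Function.update (C.env p.1) C.depth {p.2}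
  env_eq p k hk := by rw [Function.update_of_ne (by omega), C.env_eq p.1 k (by omega)]

/-- Extend a context by a variable for a set. -/
def pushSet (C : Ctx S T) : Ctx S (T × Set ℕ) where
  valid p := C.valid p.1
  word p := C.word p.1
  depth := C.depth + 1
  env p := Function.update (C.env p.1) C.depth p.2
  env_eq p k hk := by rw [Function.update_of_ne (by omega), C.env_eq p.1 k (by omega)]

/-- The number `x` is the value of a variable. -/
def IsNum (C : Ctx S T) (x : T → ℕ) : Prop :=
  ∃ k < C.depth, ∀ t, C.valid t → C.env t k = {x t} ∧ x t < C.len t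

/-- The set `X` is the value of a variable. -/
def IsSet (C : Ctx S T) (X : T → Set ℕ) : Prop :=
  ∃ k < C.depth, ∀ t, C.valid t → C.env t k = X t

theorem isNum_last {C : Ctx S T} : C.pushNum.IsNum Prod.snd :=
  ⟨C.depth, Nat.lt_succ_self _, fun p hp => ⟨by simp [pushNum], hp.2⟩⟩

theorem isSet_last {C : Ctx S T} : C.pushSet.IsSet Prod.snd :=
  ⟨C.depth, Nat.lt_succ_self _, fun p _ => by simp [pushSet]⟩

theorem IsNum.wkNum {C : Ctx S T} {x : T → ℕ} (h : C.IsNum x) : C.pushNum.IsNum fun p => x p.1 := by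
  obtain ⟨k, hk, h⟩ := h
  exact ⟨k, hk.trans (Nat.lt_succ_self _), fun p hp =>
    ⟨by simpa [pushNum, hk.ne] using (h p.1 hp.1).1, (h p.1 hp.1).2⟩⟩

theorem IsNum.wkSet {C : Ctx S T} {x : T → ℕ} (h : C.IsNum x) : C.pushSet.IsNum fun p => x p.1 := by
  obtain ⟨k, hk, h⟩ := h
  exact ⟨k, hk.trans (Nat.lt_succ_self _), fun p hp =>
    ⟨by simpa [pushSet, hk.ne] using (h p.1 hp).1, (h p.1 hp).2⟩⟩

theorem IsSet.wkNum {C : Ctx S T} {X : T → Set ℕ} (h : C.IsSet X) :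
    C.pushNum.IsSet fun p => X p.1 := by
  obtain ⟨k, hk, h⟩ := h
  exact ⟨k, hk.trans (Nat.lt_succ_self _), fun p hp => by simpa [pushNum, hk.ne] using h p.1 hp.1⟩

/-- `Sub C' C π`: every variable of `C` at `π t` is a variable of `C'` at `t`. -/
structure Sub (C' : Ctx S T') (C : Ctx S T) (π : T' → T) : Prop where
  valid : ∀ t, C'.valid t → C.valid (π t)
  word : ∀ t, C'.word t = C.word (π t)
  env : ∃ ρ : ℕ → ℕ, ∀ k < C.depth, ρ k < C'.depth ∧
    ∀ t, C'.valid t → C'.env t (ρ k) = C.env (π t) k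

theorem Sub.refl (C : Ctx S T) : Sub C C fun t => t :=
  ⟨fun _ h => h, fun _ => rfl, id, fun _ hk => ⟨hk, fun _ _ => rfl⟩⟩

theorem Sub.wkNum {C' : Ctx S T'} {C : Ctx S T} {π : T' → T} (h : Sub C' C π) :
    Sub C'.pushNum C fun p => π p.1 := by
  obtain ⟨hv, hw, ρ, hρ⟩ := h
  refine ⟨fun p hp => hv p.1 hp.1, fun p => hw p.1, ρ, fun k hk =>
    ⟨(hρ k hk).1.trans (Nat.lt_succ_self _), fun p hp => ?_⟩⟩
  simpa [pushNum, (hρ k hk).1.ne] using (hρ k hk).2 p.1 hp.1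

theorem Sub.wkSet {C' : Ctx S T'} {C : Ctx S T} {π : T' → T} (h : Sub C' C π) :
    Sub C'.pushSet C fun p => π p.1 := by
  obtain ⟨hv, hw, ρ, hρ⟩ := h
  refine ⟨fun p hp => hv p.1 hp, fun p => hw p.1, ρ, fun k hk =>
    ⟨(hρ k hk).1.trans (Nat.lt_succ_self _), fun p hp => ?_⟩⟩
  simpa [pushSet, (hρ k hk).1.ne] using (hρ k hk).2 p.1 hp

theorem Sub.num {C' : Ctx S T'} {C : Ctx S T} {π : T' → T} (h : Sub C' C π) {x : T' → ℕ}
    (hx : C'.IsNum x) : Sub C' C.pushNum fun t => (π t, x t) := by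
  obtain ⟨hv, hw, ρ, hρ⟩ := h
  obtain ⟨j, hj, hx⟩ := hx
  refine ⟨fun t ht => ⟨hv t ht, by
    have := (hx t ht).2
    rwa [Ctx.len, hw] at this⟩, hw,
    Function.update ρ C.depth j, fun k hk => ?_⟩
  by_cases hkd : k = C.depth
  · subst hkd
    simpa [pushNum, hj] using fun t ht => (hx t ht).1
  · have hk' : k < C.depth := by
      have : k < C.depth + 1 := hk
      omega
    simpa [pushNum, hkd] using hρ k hk'

end Ctx

open Ctx

/-- A relation between the values of the variables is definable if it is given by a formula. -/
def Definable (C : Ctx S T) (P : T → Prop) : Prop :=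
  ∃ φ : Fml S, ∀ t, C.valid t → (φ.eval (C.word t) C.depth (C.env t) ↔ P t)

/-- A function is definable if its graph is. The values that exceed the length of the word play no
role. -/
def DefFun (C : Ctx S T) (f : T → ℕ) : Prop :=
  Definable C.pushNum fun p => p.2 = f p.1

variable {C : Ctx S T}

namespace Definable

variable {P Q : T → Prop}

theorem congr (h : Definable C P) (hPQ : ∀ t, C.valid t → (Q t ↔ P t)) : Definable C Q := by
  obtain ⟨φ, h⟩ := h
  exact ⟨φ, fun t ht => (h t ht).trans (hPQ t ht).symm⟩

/-- Substitution of variables. -/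
theorem comap {C' : Ctx S T'} {π : T' → T} (h : Definable C P) (hπ : Sub C' C π) :
    Definable C' fun t => P (π t) := by
  obtain ⟨φ, h⟩ := h
  obtain ⟨hv, hw, ρ, hρ⟩ := hπ
  refine ⟨φ.rename fun k => if k < C.depth then ρ k else k - C.depth + C'.depth, fun t ht => ?_⟩
  refine Iff.trans ?_ (h (π t) (hv t ht))
  rw [hw]
  refine Fml.eval_rename _ _ _ _ _ _ _ (fun k hk => ?_) (fun j => ?_) fun k => ?_
  · simpa [hk] using (hρ k hk).1
  · simp [add_comm]
  · by_cases hk : k < C.depth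
    · simpa [hk] using (hρ k hk).2 t ht
    · simp only [hk, if_false]
      rw [C'.env_eq _ _ (by omega), C.env_eq _ _ (by omega)]

theorem wkNum (h : Definable C P) : Definable C.pushNum fun p => P p.1 :=
  h.comap (Sub.refl C).wkNum

theorem nand (hP : Definable C P) (hQ : Definable C Q) : Definable C fun t => ¬ (P t ∧ Q t) := by
  obtain ⟨φ, hφ⟩ := hP
  obtain ⟨ψ, hψ⟩ := hQ
  exact ⟨φ.nand ψ, fun t ht => by rw [Fml.eval, hφ t ht, hψ t ht]⟩

theorem not (hP : Definable C P) : Definable C fun t => ¬ P t :=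
  (hP.nand hP).congr fun t _ => by simp

theorem and (hP : Definable C P) (hQ : Definable C Q) : Definable C fun t => P t ∧ Q t :=
  (hP.nand hQ).not.congr fun t _ => by simp

theorem or (hP : Definable C P) (hQ : Definable C Q) : Definable C fun t => P t ∨ Q t :=
  (hP.not.nand hQ.not).congr fun t _ => by tauto

theorem mem_set {X : T → Set ℕ} {x : T → ℕ} (hX : C.IsSet X) (hx : C.IsNum x) :
    Definable C fun t => x t ∈ X t := by
  obtain ⟨j, hj, hX⟩ := hX
  obtain ⟨k, hk, hx⟩ := hx
  refine ⟨.mem j k, fun t ht => ?_⟩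
  have := (hx t ht).2
  simp [Fml.eval, hX t ht, (hx t ht).1, this]

theorem lt_num {x y : T → ℕ} (hx : C.IsNum x) (hy : C.IsNum y) :
    Definable C fun t => x t < y t := by
  obtain ⟨j, hj, hx⟩ := hx
  obtain ⟨k, hk, hy⟩ := hy
  refine ⟨.lt j k, fun t ht => ?_⟩
  have := (hy t ht).2
  simp [Fml.eval, (hx t ht).1, (hy t ht).1, this]

theorem eq_num {x y : T → ℕ} (hx : C.IsNum x) (hy : C.IsNum y) :
    Definable C fun t => x t = y t :=
  ((lt_num hx hy).not.and (lt_num hy hx).not).congr fun t _ => by omega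

theorem letter_num (a : S) {x : T → ℕ} (hx : C.IsNum x) :
    Definable C fun t => (C.word t)[x t]? = some a := by
  obtain ⟨k, hk, hx⟩ := hx
  refine ⟨.letter a k, fun t ht => ?_⟩
  have := (hx t ht).2
  simp [Fml.eval, (hx t ht).1, this]

/-- Definable recursion on sets. -/
theorem iter {Φ : T → Set ℕ → ℕ → ℕ → Prop} {Q : T × Set ℕ → Prop} (A : T → ℕ → Set ℕ)
    (hΦ : Definable C.pushSet.pushNum.pushNum fun p => Φ p.1.1.1 p.1.1.2 p.1.2 p.2)
    (hQ : Definable C.pushSet Q) (h0 : ∀ t, A t 0 = ∅)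
    (hs : ∀ t, C.valid t → ∀ i < C.len t,
      A t (i + 1) = {x | x < C.len t ∧ Φ t (A t i) i x}) :
    Definable C fun t => Q (t, A t (C.len t)) := by
  obtain ⟨φ, hφ⟩ := hΦ
  obtain ⟨ψ, hψ⟩ := hQ
  refine ⟨.iter φ ψ, fun t ht => ?_⟩
  have hstage : ∀ i ≤ C.len t, φ.stage (C.word t) C.depth (C.env t) i = A t i := by
    intro i
    induction i with
    | zero => intro _; exact (h0 t).symm
    | succ i ih =>
      intro hi
      rw [hs t ht i (by omega), ← ih (by omega)]
      ext x
      refine and_congr_right fun hx => ?_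
      exact hφ (((t, φ.stage (C.word t) C.depth (C.env t) i), i), x) ⟨⟨ht, by
        change i < C.len t; omega⟩, hx⟩
  change _ ↔ Q (t, A t (C.len t))
  rw [← hstage _ le_rfl]
  exact hψ (t, φ.stage (C.word t) C.depth (C.env t) (C.len t)) ht

/-- Quantifiers come from iteration: all positions enter the set after the first witness. -/
theorem exists_lt {P : T × ℕ → Prop} (hP : Definable C.pushNum P) :
    Definable C fun t => ∃ i < C.len t, P (t, i) := by
  have hne : Definable C.pushSet fun p => ∃ i < C.len p.1, i ∈ p.2 :=
    ⟨.mem C.depth C.depth, fun p _ => by simp [Fml.eval, pushSet]⟩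
  refine (Definable.iter (Φ := fun t X i x => x ∈ X ∨ P (t, i))
    (fun t i => {x | x < C.len t ∧ ∃ j < i, P (t, j)}) ?_ hne (fun t => by simp) ?_).congr fun t _ => ?_
  · exact (mem_set isSet_last.wkNum.wkNum isNum_last).or
      (hP.comap ((Sub.refl C).wkSet.wkNum.wkNum.num isNum_last.wkNum))
  · intro t _ i _
    ext x
    simp only [Set.mem_ofPred_eq, Nat.lt_succ_iff_lt_or_eq, or_and_right, exists_or,
      exists_eq_left]
    refine and_congr_right fun hx => ?_
    simp only [hx, true_and]
  · constructor
    · rintro ⟨i, hi, h⟩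
      exact ⟨i, hi, hi, i, hi, h⟩
    · rintro ⟨_, _, _, h⟩
      exact h

theorem forall_lt {P : T × ℕ → Prop} (hP : Definable C.pushNum P) :
    Definable C fun t => ∀ i < C.len t, P (t, i) :=
  hP.not.exists_lt.not.congr fun t _ => by simp

/-- Substitution of a definable function. The hypothesis `hlt` is needed because the graph of `f` is
known only below the length of the word. -/
theorem subst {P : T × ℕ → Prop} {f : T → ℕ} (hP : Definable C.pushNum P)
    (hf : DefFun C f) (hlt : ∀ t, C.valid t → P (t, f t) → f t < C.len t) :
    Definable C fun t => P (t, f t) :=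
  (exists_lt (Definable.and hf hP)).congr fun t ht =>
    ⟨fun h => ⟨f t, hlt t ht h, rfl, h⟩, fun ⟨_, _, hi, h⟩ => hi ▸ h⟩

end Definable

namespace DefFun

variable {f g : T → ℕ} {P : T → Prop}

theorem of_num {x : T → ℕ} (hx : C.IsNum x) : DefFun C x :=
  Definable.eq_num isNum_last hx.wkNum

theorem last : DefFun C.pushNum Prod.snd := of_num isNum_last

theorem congr (hf : DefFun C f) (h : ∀ t, C.valid t → g t = f t) : DefFun C g :=
  Definable.congr hf fun p hp => by rw [h p.1 hp.1]

theorem comap {C' : Ctx S T'} {π : T' → T} (h : DefFun C f) (hπ : Sub C' C π) :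
    DefFun C' fun t => f (π t) :=
  Definable.comap h (hπ.wkNum.num isNum_last)

theorem wkNum (h : DefFun C f) : DefFun C.pushNum fun p => f p.1 :=
  h.comap (Sub.refl C).wkNum

theorem ite [∀ t, Decidable (P t)] (hP : Definable C P) (hf : DefFun C f) (hg : DefFun C g) :
    DefFun C fun t => if P t then f t else g t :=
  ((hP.wkNum.and hf).or (hP.wkNum.not.and hg)).congr fun p _ => by
    by_cases h : P p.1 <;> simp [h]

theorem zero : DefFun C fun _ => 0 :=
  (Definable.lt_num isNum_last isNum_last.wkNum).exists_lt.not.congr fun p hp => by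
    constructor
    · rintro h ⟨i, _, hi⟩
      change p.2 = 0 at h
      change i < p.2 at hi
      omega
    · intro h
      by_contra h0
      exact h ⟨0, Nat.zero_lt_of_lt hp.2, Nat.pos_of_ne_zero h0⟩

end DefFun

namespace Definable

variable {f g : T → ℕ}

theorem lt (hf : DefFun C f) (hg : DefFun C g) (hlt : ∀ t, C.valid t → g t < C.len t) :
    Definable C fun t => f t < g t := by
  refine Definable.subst (P := fun p => p.2 < g p.1) ?_ hf fun t ht h => h.trans (hlt t ht)
  exact Definable.subst (P := fun p => p.1.2 < p.2)
    (lt_num (x := fun p : (T × ℕ) × ℕ => p.1.2) isNum_last.wkNum isNum_last) hg.wkNum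
    fun p hp _ => hlt p.1 hp.1

theorem le (hf : DefFun C f) (hg : DefFun C g) (hlt : ∀ t, C.valid t → f t < C.len t) :
    Definable C fun t => f t ≤ g t :=
  (lt hg hf hlt).not.congr fun _ _ => not_lt.symm

theorem eq (hf : DefFun C f) (hg : DefFun C g) (hlt : ∀ t, C.valid t → f t < C.len t) :
    Definable C fun t => f t = g t :=
  Definable.subst hg hf fun t ht _ => hlt t ht

/-- Definability of the numbers that are reachable from `0` by as many steps as the word has
positions, where the `i`-th step leads from `v` to any `x` with `R i v x`. -/
theorem chain {R : T → ℕ → ℕ → ℕ → Prop} (A : T → ℕ → ℕ → Prop)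
    (hR : Definable C.pushNum.pushNum.pushNum fun p => R p.1.1.1 p.1.1.2 p.1.2 p.2)
    (h0 : ∀ t x, A t 0 x ↔ x = 0)
    (hs : ∀ t, C.valid t → ∀ i < C.len t, ∀ x < C.len t,
      A t (i + 1) x ↔ ∃ v < C.len t, A t i v ∧ R t i v x) :
    Definable C.pushNum fun p => A p.1 (C.len p.1) p.2 := by
  -- The iteration starts with the empty set instead of `{0}`, so the step `0` supplies `0` itself.
  have hstep : Definable C.pushNum.pushSet.pushNum.pushNum
      (fun p => ∃ v < C.len p.1.1.1.1, (v ∈ p.1.1.2 ∨ p.1.2 = 0 ∧ v = 0) ∧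
        R p.1.1.1.1 p.1.2 v p.2) := by
    refine exists_lt (C := C.pushNum.pushSet.pushNum.pushNum)
      (P := fun q => (q.2 ∈ q.1.1.1.2 ∨ q.1.1.2 = 0 ∧ q.2 = 0) ∧
        R q.1.1.1.1.1 q.1.1.2 q.2 q.1.2) ?_
    refine ((mem_set isSet_last.wkNum.wkNum.wkNum isNum_last).or
      ((subst DefFun.zero (DefFun.of_num isNum_last.wkNum.wkNum) ?_).and
      (subst DefFun.zero (DefFun.of_num isNum_last) ?_))).and
      (hR.comap (((Sub.refl C).wkNum.wkSet.wkNum.wkNum.wkNum.num isNum_last.wkNum.wkNum).num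
        isNum_last |>.num isNum_last.wkNum))
    · exact fun p hp _ => hp.1.1.2
    · exact fun p hp _ => hp.2
  refine (iter (C := C.pushNum) (Q := fun p => p.1.2 ∈ p.2)
    (Φ := fun p X i x => ∃ v < C.len p.1, (v ∈ X ∨ i = 0 ∧ v = 0) ∧ R p.1 i v x)
    (fun p i => {x | i ≠ 0 ∧ x < C.len p.1 ∧ A p.1 i x}) hstep
    (mem_set isSet_last isNum_last.wkSet) (fun p => by simp) ?_).congr ?_
  · rintro ⟨t, y⟩ ⟨ht, hy⟩ i hi
    have hpos : 0 < C.len t := by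
      change y < C.len t at hy
      omega
    ext x
    change i + 1 ≠ 0 ∧ x < C.len t ∧ A t (i + 1) x ↔ x < C.len t ∧ ∃ v < C.len t,
      ((i ≠ 0 ∧ v < C.len t ∧ A t i v) ∨ i = 0 ∧ v = 0) ∧ R t i v x
    simp only [ne_eq, Nat.add_eq_zero_iff, one_ne_zero, and_false, not_false_eq_true, true_and]
    refine and_congr_right fun hx => ?_
    rw [hs t ht i hi x hx]
    refine exists_congr fun v => and_congr_right fun hv => and_congr_left fun _ => ?_
    by_cases hi0 : i = 0
    · subst hi0
      simp [h0]
    · simp [hi0, hv]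
  · rintro ⟨t, y⟩ ⟨ht, hy⟩
    change y < C.len t at hy
    change A t (C.len t) y ↔ C.len t ≠ 0 ∧ y < C.len t ∧ A t (C.len t) y
    have : C.len t ≠ 0 := by omega
    simp [this, hy]

end Definable

namespace DefFun

variable {f g : T → ℕ} {P : T → Prop}

/-- Definable recursion on numbers. As the values increase, those that precede a value below the
length of the word are also below it, so no value that matters is lost. -/
theorem nat_rec {g : T → ℕ → ℕ → ℕ} (s : T → ℕ → ℕ)
    (hg : DefFun C.pushNum.pushNum fun p => g p.1.1 p.1.2 p.2)
    (h0 : ∀ t, s t 0 = 0) (hs : ∀ t i, s t (i + 1) = g t i (s t i))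
    (hmono : ∀ t i, s t i ≤ s t (i + 1)) : DefFun C fun t => s t (C.len t) :=
  Definable.chain (R := fun t i v x => x = g t i v) (fun t i x => x = s t i) hg
    (fun t x => by rw [h0]) fun t _ i _ x hx => by
      constructor
      · intro h
        exact ⟨s t i, (hmono t i).trans_lt (h ▸ hx), rfl, by rw [h, hs]⟩
      · rintro ⟨v, _, rfl, h⟩
        rw [h, hs]

/-- The successor of `x` is the number above `x` with nothing in between. -/
theorem succ_num {x : T → ℕ} (hx : C.IsNum x) : DefFun C fun t => x t + 1 := by
  refine ((Definable.lt_num hx.wkNum isNum_last).and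
    ((Definable.lt_num hx.wkNum.wkNum isNum_last).and
      (Definable.lt_num isNum_last isNum_last.wkNum)).exists_lt.not).congr fun p hp => ?_
  have hp2 : p.2 < C.len p.1 := hp.2
  change p.2 = x p.1 + 1 ↔ x p.1 < p.2 ∧ ¬ ∃ i < C.len p.1, x p.1 < i ∧ i < p.2
  constructor
  · intro h
    refine ⟨by omega, ?_⟩
    rintro ⟨i, _, h1, h2⟩
    omega
  · rintro ⟨h1, h2⟩
    by_contra h
    exact h2 ⟨x p.1 + 1, by omega, by omega, by omega⟩

theorem count {P : T × ℕ → Prop} [∀ t, DecidablePred fun i => P (t, i)]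
    (hP : Definable C.pushNum P) :
    DefFun C fun t => ((Finset.range (C.len t)).filter fun i => P (t, i)).card := by
  refine nat_rec (g := fun t i v => if P (t, i) then v + 1 else v)
    (fun t i => ((Finset.range i).filter fun i => P (t, i)).card)
    (ite (P := fun p => P p.1) hP.wkNum (succ_num isNum_last) last)
    (fun t => by simp) (fun t i => ?_) (fun t i => ?_)
  · rw [Finset.range_add_one, Finset.filter_insert]
    split_ifs
    · rw [Finset.card_insert_of_notMem (by simp)]
    · rfl
  · exact Finset.card_le_card (Finset.filter_subset_filter _
      (Finset.range_subset_range.2 (Nat.le_succ i)))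

/-- The equation `z = x + y` says that `x ≤ z` and that there are `y` numbers `i` with `x ≤ i < z`. -/
theorem add (hf : DefFun C f) (hg : DefFun C g) : DefFun C fun t => f t + g t := by
  have hcount : DefFun C.pushNum.pushNum fun p => ((Finset.range (C.len p.1.1)).filter
      fun i => p.2 ≤ i ∧ i < p.1.2).card :=
    count (P := fun q : ((T × ℕ) × ℕ) × ℕ => q.1.2 ≤ q.2 ∧ q.2 < q.1.1.2)
      (((Definable.lt_num isNum_last isNum_last.wkNum).not.congr fun _ _ => not_lt.symm).and
        (Definable.lt_num isNum_last isNum_last.wkNum.wkNum))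
  have key : ∀ n x z : ℕ, z < n → ((Finset.range n).filter fun i => x ≤ i ∧ i < z).card = z - x := by
    intro n x z hz
    rw [← Nat.card_Ico]
    congr 1
    ext i
    simp only [Finset.mem_filter, Finset.mem_range, Finset.mem_Ico]
    omega
  refine (Definable.exists_lt (C := C.pushNum) (P := fun q => (q.2 = f q.1.1 ∧ q.2 ≤ q.1.2) ∧
    g q.1.1 = ((Finset.range (C.len q.1.1)).filter fun i => q.2 ≤ i ∧ i < q.1.2).card) ?_).congr ?_
  · refine Definable.and (Definable.and ?_ ?_) ?_
    · exact hf.comap (Sub.refl C).wkNum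
    · exact (Definable.lt_num isNum_last.wkNum isNum_last).not.congr fun _ _ => not_lt.symm
    · refine (Definable.eq hcount hg.wkNum.wkNum ?_).congr fun _ _ => eq_comm
      rintro ⟨⟨t, z⟩, x⟩ ⟨⟨_, hz⟩, _⟩
      change z < C.len t at hz
      change Finset.card _ < C.len t
      rw [key _ _ _ hz]
      omega
  · rintro ⟨t, z⟩ ⟨ht, hz⟩
    change z < C.len t at hz
    change z = f t + g t ↔ ∃ x < C.len t, (x = f t ∧ x ≤ z) ∧ g t = Finset.card _
    constructor
    · intro h
      exact ⟨f t, by omega, ⟨rfl, by omega⟩, by rw [key _ _ _ hz]; omega⟩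
    · rintro ⟨x, _, ⟨rfl, hxz⟩, h⟩
      rw [key _ _ _ hz] at h
      omega

theorem sum {f : T × ℕ → ℕ} (hf : DefFun C.pushNum f) :
    DefFun C fun t => ∑ i ∈ Finset.range (C.len t), f (t, i) :=
  nat_rec (g := fun t i v => v + f (t, i)) (fun t i => ∑ j ∈ Finset.range i, f (t, j))
    (last.add hf.wkNum) (fun t => by simp) (fun t i => Finset.sum_range_succ _ _)
    (fun t i => by rw [Finset.sum_range_succ]; exact Nat.le_add_right _ _)

theorem one : DefFun C fun _ => 1 :=
  Definable.subst (P := fun q : (T × ℕ) × ℕ => q.1.2 = q.2 + 1)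
    (Definable.comap (succ_num (C := C.pushNum) isNum_last)
      (((Sub.refl C).wkNum.wkNum.num isNum_last).num isNum_last.wkNum))
    zero fun _ hp _ => Nat.zero_lt_of_lt hp.2

/-- A product `x * y` is the sum, over all positions, of `y` at those below `x`. -/
theorem mul (hf : DefFun C f) (hg : DefFun C g) (hlt : ∀ t, C.valid t → f t < C.len t) :
    DefFun C fun t => f t * g t :=
  (sum (ite (Definable.lt last hf.wkNum fun p hp => hlt p.1 hp.1) hg.wkNum zero)).congr
    fun t ht => by
      change f t * g t = ∑ i ∈ Finset.range (C.len t), if i < f t then g t else 0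
      rw [← Finset.sum_filter, Finset.sum_const, smul_eq_mul]
      congr 1
      have : (Finset.range (C.len t)).filter (fun i => i < f t) = Finset.range (f t) := by
        ext i
        have := hlt t ht
        simp only [Finset.mem_filter, Finset.mem_range]
        omega
      rw [this, Finset.card_range]

end DefFun

/-- The sums of choices from a definable family of sets are definable: they are computed by
dynamic programming. -/
theorem Definable.sum_choice {O : T → ℕ → ℕ → Prop}
    (hO : Definable C.pushNum.pushNum fun p => O p.1.1 p.1.2 p.2) :
    Definable C.pushNum fun p => ∃ o : ℕ → ℕ, (∀ i < C.len p.1, O p.1 i (o i)) ∧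
      p.2 = ∑ i ∈ Finset.range (C.len p.1), o i := by
  refine Definable.chain (R := fun t i v x => ∃ y < C.len t, O t i y ∧ x = v + y)
    (fun t n x => ∃ o : ℕ → ℕ, (∀ i < n, O t i (o i)) ∧ x = ∑ i ∈ Finset.range n, o i)
    ?_ (fun t x => by simp) ?_
  · refine Definable.exists_lt (C := C.pushNum.pushNum.pushNum)
      (P := fun q => O q.1.1.1.1 q.1.1.1.2 q.2 ∧ q.1.2 = q.1.1.2 + q.2) (Definable.and ?_ ?_)
    · exact hO.comap (((Sub.refl C).wkNum.wkNum.wkNum.wkNum.num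
        isNum_last.wkNum.wkNum.wkNum).num isNum_last)
    · exact Definable.comap ((DefFun.of_num (isNum_last (C := C)).wkNum).add DefFun.last)
        ((((Sub.refl C).wkNum.wkNum.wkNum.wkNum.num isNum_last.wkNum.wkNum).num
          isNum_last).num isNum_last.wkNum)
  · intro t _ i _ x hx
    constructor
    · rintro ⟨o, ho, h⟩
      rw [Finset.sum_range_succ] at h
      exact ⟨_, by omega, ⟨o, fun j hj => ho j (by omega), rfl⟩, o i, by omega,
        ho i (by omega), h⟩
    · rintro ⟨v, _, ⟨o, ho, rfl⟩, y, _, hy, rfl⟩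
      refine ⟨Function.update o i y, fun j hj => ?_, ?_⟩
      · by_cases hji : j = i
        · subst hji
          simpa using hy
        · simpa [hji] using ho j (by omega)
      · rw [Finset.sum_range_succ, Function.update_self]
        congr 1
        refine Finset.sum_congr rfl fun j hj => ?_
        rw [Function.update_of_ne (Finset.mem_range.1 hj).ne]

end Definable

end InfluenceSpread

/-! ### Reading the description of a game -/

namespace InfluenceSpread

section Parse

open scoped Classical

/-- The number of words that end before position `p`. -/
noncomputable def wordIdx (w : List (Option Bool)) (p : ℕ) : ℕ :=
  Nat.count (fun i => w[i]? = some none) p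

/-- The number of earlier positions in the word to which position `p` belongs. -/
noncomputable def letterIdx (w : List (Option Bool)) (p : ℕ) : ℕ :=
  Nat.count (fun i => wordIdx w i = wordIdx w p) p

theorem count_eq_zero_of_forall {P : ℕ → Prop} [DecidablePred P] {n : ℕ}
    (h : ∀ i < n, ¬ P i) : Nat.count P n = 0 := by
  rw [Nat.count_eq_card_filter_range, Finset.card_eq_zero, Finset.filter_eq_empty_iff]
  simpa using h

theorem count_eq_self_of_forall {P : ℕ → Prop} [DecidablePred P] {n : ℕ}
    (h : ∀ i < n, P i) : Nat.count P n = n := by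
  rw [Nat.count_eq_card_filter_range, Finset.filter_true_of_mem (by simpa using h),
    Finset.card_range]

section Cons

variable (v : List Bool) (l : List (List Bool))

theorem joinWords_cons : joinWords (v :: l) = v.map some ++ [none] ++ joinWords l := by
  simp [joinWords]

theorem getElem?_joinWords_lt {i : ℕ} (hi : i < v.length + 1) :
    (joinWords (v :: l))[i]? = some v[i]? := by
  rw [joinWords_cons, List.getElem?_append_left (by simpa using hi)]
  rcases Nat.lt_succ_iff_lt_or_eq.1 hi with hi | rfl
  · rw [List.getElem?_append_left (by simpa using hi)]
    simp [hi]
  · simp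

theorem getElem?_joinWords_add (i : ℕ) :
    (joinWords (v :: l))[v.length + 1 + i]? = (joinWords l)[i]? := by
  rw [joinWords_cons, List.getElem?_append_right (by simp)]
  simp

theorem wordIdx_cons_lt {p : ℕ} (hp : p < v.length + 1) : wordIdx (joinWords (v :: l)) p = 0 := by
  refine count_eq_zero_of_forall fun i hi => ?_
  have hiv : i < v.length := by omega
  rw [getElem?_joinWords_lt v l (by omega)]
  simp [hiv]

theorem wordIdx_cons_add (p : ℕ) :
    wordIdx (joinWords (v :: l)) (v.length + 1 + p) = wordIdx (joinWords l) p + 1 := by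
  have h : wordIdx (joinWords (v :: l)) (v.length + 1) = 1 := by
    have := wordIdx_cons_lt v l (Nat.lt_succ_self v.length)
    unfold wordIdx at this ⊢
    rw [Nat.count_succ, this, getElem?_joinWords_lt v l (Nat.lt_succ_self _)]
    simp
  unfold wordIdx at h ⊢
  rw [Nat.count_add, h, add_comm]
  simp only [getElem?_joinWords_add]

theorem letterIdx_cons_lt {p : ℕ} (hp : p < v.length + 1) :
    letterIdx (joinWords (v :: l)) p = p :=
  count_eq_self_of_forall fun i hi => by
    rw [wordIdx_cons_lt v l hp, wordIdx_cons_lt v l (hi.trans hp)]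

theorem letterIdx_cons_add (p : ℕ) :
    letterIdx (joinWords (v :: l)) (v.length + 1 + p) = letterIdx (joinWords l) p := by
  unfold letterIdx
  rw [Nat.count_add, count_eq_zero_of_forall, zero_add]
  · simp only [wordIdx_cons_add, Nat.add_right_cancel_iff]
  · intro i hi
    rw [wordIdx_cons_lt v l hi, wordIdx_cons_add]
    omega

end Cons

theorem joinWords_getElem? (l : List (List Bool)) : ∀ p < (joinWords l).length,
    wordIdx (joinWords l) p < l.length ∧
    (joinWords l)[p]? = some (l.getD (wordIdx (joinWords l) p) [])[letterIdx (joinWords l) p]? := by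
  induction l with
  | nil => intro p hp; simp [joinWords] at hp
  | cons v l ih =>
    intro p hp
    rcases lt_or_ge p (v.length + 1) with h | h
    · rw [wordIdx_cons_lt v l h, letterIdx_cons_lt v l h, getElem?_joinWords_lt v l h]
      simp
    · obtain ⟨p, rfl⟩ := Nat.exists_eq_add_of_le h
      have hp' : p < (joinWords l).length := by
        rw [joinWords_cons] at hp
        simp at hp
        omega
      rw [wordIdx_cons_add, letterIdx_cons_add, getElem?_joinWords_add]
      simpa using ih p hp'

/-- The position `j = v.length` in a word `v` is that of its end mark. -/
theorem exists_position (l : List (List Bool)) : ∀ c < l.length, ∀ j ≤ (l.getD c []).length,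
    ∃ p < (joinWords l).length, wordIdx (joinWords l) p = c ∧ letterIdx (joinWords l) p = j := by
  induction l with
  | nil => intro c hc; simp at hc
  | cons v l ih =>
    intro c hc j hj
    have hlen : (joinWords (v :: l)).length = v.length + 1 + (joinWords l).length := by
      simp [joinWords_cons]
      omega
    cases c with
    | zero =>
      have hj' : j < v.length + 1 := by
        simp at hj
        omega
      exact ⟨j, by omega, wordIdx_cons_lt v l hj', letterIdx_cons_lt v l hj'⟩
    | succ c =>
      obtain ⟨p, hp, h1, h2⟩ := ih c (by simpa using hc) j (by simpa using hj)
      exact ⟨v.length + 1 + p, by omega, by rw [wordIdx_cons_add, h1],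
        by rw [letterIdx_cons_add, h2]⟩

theorem count_wordIdx (l : List (List Bool)) : ∀ c < l.length,
    Nat.count (fun i => wordIdx (joinWords l) i = c) (joinWords l).length =
      (l.getD c []).length + 1 := by
  induction l with
  | nil => intro c hc; simp at hc
  | cons v l ih =>
    intro c hc
    have hlen : (joinWords (v :: l)).length = v.length + 1 + (joinWords l).length := by
      simp [joinWords_cons]
      omega
    rw [hlen, Nat.count_add]
    simp only [wordIdx_cons_add]
    cases c with
    | zero =>
      rw [count_eq_self_of_forall fun i hi => wordIdx_cons_lt v l hi,
        count_eq_zero_of_forall (by simp)]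
      simp
    | succ c =>
      rw [count_eq_zero_of_forall fun i hi => by rw [wordIdx_cons_lt v l hi]; simp]
      simpa using ih c (by simpa using hc)

/-- The letter `j` of the word `c` of a list of words is `true`. -/
def bit (w : List (Option Bool)) (c j : ℕ) : Prop :=
  ∃ p < w.length, w[p]? = some (some true) ∧ wordIdx w p = c ∧ letterIdx w p = j

theorem bit_joinWords (l : List (List Bool)) (c j : ℕ) :
    bit (joinWords l) c j ↔ (l.getD c [])[j]? = some true := by
  constructor
  · rintro ⟨p, hp, h, rfl, rfl⟩
    rw [(joinWords_getElem? l p hp).2] at h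
    simpa using h
  · intro h
    have hc : c < l.length := by
      by_contra hc
      simp [List.getElem?_eq_none (not_lt.1 hc)] at h
    obtain ⟨hj, -⟩ := List.getElem?_eq_some_iff.1 h
    obtain ⟨p, hp, rfl, rfl⟩ := exists_position l c hc j hj.le
    refine ⟨p, hp, ?_, rfl, rfl⟩
    rw [(joinWords_getElem? l p hp).2, h]

namespace MinInfluenceGame

variable (Γ : MinInfluenceGame)

/-- The players, as natural numbers. -/
def IsPlayer (v : ℕ) : Prop := ∃ h : v < Γ.n, (⟨v, h⟩ : Fin Γ.n) ∈ Γ.players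

/-- The adjacency relation between natural numbers. -/
def Adj (u v : ℕ) : Prop := ∃ (hu : u < Γ.n) (hv : v < Γ.n), Γ.graph.Adj ⟨u, hu⟩ ⟨v, hv⟩

theorem bit_player (v : ℕ) : bit Γ.encode 1 v ↔ Γ.IsPlayer v := by
  rw [encode, bit_joinWords]
  simp [words, IsPlayer, List.getElem?_eq_some_iff]

theorem bit_adj (u v : ℕ) : bit Γ.encode (u + 2) v ↔ Γ.Adj u v := by
  rw [encode, bit_joinWords]
  by_cases hu : u < Γ.n
  · simp [words, Adj, List.getElem?_eq_some_iff, hu]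
  · simp [words, Adj, hu]

theorem length_encode : Γ.encode.length = Γ.quota + 1 + (Γ.n + 1) * (Γ.n + 1) := by
  simp [encode, joinWords, words, List.length_flatMap, Function.comp_def]
  ring

/-- The first word of a description consists of `quota` letters, followed by the end mark. -/
theorem count_quota :
    Nat.count (fun i => wordIdx Γ.encode i = 0) Γ.encode.length = Γ.quota + 1 := by
  rw [encode, count_wordIdx _ _ (by simp [words])]
  simp [words]

theorem count_order : Nat.count (fun i => wordIdx Γ.encode i = 1) Γ.encode.length = Γ.n + 1 := by
  rw [encode, count_wordIdx _ _ (by simp [words])]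
  simp [words]

end MinInfluenceGame

end Parse

end InfluenceSpread

/-! ### Definability of the structure of a game -/

namespace InfluenceSpread

section Games

open scoped Classical
open Ctx

variable {S T : Type}

theorem DefFun.count_lt {C : Ctx S T} {P : T × ℕ → Prop} {f : T → ℕ}
    [∀ t, DecidablePred fun i => P (t, i)] (hP : Definable C.pushNum P) (hf : DefFun C f)
    (hlt : ∀ t, C.valid t → f t < C.len t) :
    DefFun C fun t => Nat.count (fun i => P (t, i)) (f t) := by
  refine (DefFun.count (P := fun p => p.2 < f p.1 ∧ P p) (Definable.and (Definable.lt last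
    hf.wkNum fun p hp => hlt p.1 hp.1) hP)).congr fun t ht => ?_
  rw [Nat.count_eq_card_filter_range]
  congr 1
  ext i
  have := hlt t ht
  simp only [Finset.mem_filter, Finset.mem_range]
  constructor
  · rintro ⟨h1, h2⟩
    exact ⟨h1.trans this, h1, h2⟩
  · rintro ⟨-, h1, h2⟩
    exact ⟨h1, h2⟩

variable {C : Ctx (Option Bool) T} {f g : T → ℕ}

theorem wordIdx_le (w : List (Option Bool)) (p : ℕ) : wordIdx w p ≤ p := Nat.count_le _

theorem letterIdx_le (w : List (Option Bool)) (p : ℕ) : letterIdx w p ≤ p := Nat.count_le _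

theorem DefFun.wordIdx (hf : DefFun C f) (hlt : ∀ t, C.valid t → f t < C.len t) :
    DefFun C fun t => wordIdx (C.word t) (f t) :=
  DefFun.count_lt (P := fun p => (C.word p.1)[p.2]? = some none)
    (Definable.letter_num (C := C.pushNum) none isNum_last) hf hlt

theorem DefFun.letterIdx (hf : DefFun C f) (hlt : ∀ t, C.valid t → f t < C.len t) :
    DefFun C fun t => letterIdx (C.word t) (f t) :=
  DefFun.count_lt (P := fun p => InfluenceSpread.wordIdx (C.word p.1) p.2 =
      InfluenceSpread.wordIdx (C.word p.1) (f p.1))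
    (Definable.eq (DefFun.wordIdx (C := C.pushNum) last fun _ hp => hp.2) (DefFun.wordIdx hf hlt).wkNum
      fun _ hp => (wordIdx_le _ _).trans_lt hp.2) hf hlt

theorem Definable.bit (hf : DefFun C f) (hg : DefFun C g) :
    Definable C fun t => bit (C.word t) (f t) (g t) := by
  refine Definable.exists_lt (P := fun p => (C.word p.1)[p.2]? = some (some true) ∧
    wordIdx (C.word p.1) p.2 = f p.1 ∧ letterIdx (C.word p.1) p.2 = g p.1) ?_
  refine (Definable.letter_num (C := C.pushNum) (some true) isNum_last).and (Definable.and ?_ ?_)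
  · exact Definable.eq (DefFun.wordIdx (C := C.pushNum) DefFun.last fun _ hp => hp.2) hf.wkNum
      fun p hp => (wordIdx_le _ _).trans_lt hp.2
  · exact Definable.eq (DefFun.letterIdx (C := C.pushNum) DefFun.last fun _ hp => hp.2) hg.wkNum
      fun p hp => (letterIdx_le _ _).trans_lt hp.2

/-- The length of a word, together with its end mark, is the number of positions that belong to it. -/
theorem DefFun.count_wordIdx (hf : DefFun C f) :
    DefFun C fun t => Nat.count (fun i => InfluenceSpread.wordIdx (C.word t) i = f t) (C.len t) := by
  refine (DefFun.count (P := fun p => InfluenceSpread.wordIdx (C.word p.1) p.2 = f p.1)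
    (Definable.eq (DefFun.wordIdx (C := C.pushNum) last fun _ hp => hp.2) hf.wkNum
      fun _ hp => (wordIdx_le _ _).trans_lt hp.2)).congr fun t _ => ?_
  rw [Nat.count_eq_card_filter_range]

namespace MinInfluenceGame

/-- The words of the context are the descriptions of the games `Γ t`. -/
def Describes (C : Ctx (Option Bool) T) (Γ : T → MinInfluenceGame) : Prop :=
  ∀ t, C.word t = (Γ t).encode

variable {Γ : T → MinInfluenceGame}

theorem Describes.wkNum (h : Describes C Γ) : Describes C.pushNum fun p => Γ p.1 := fun p => h p.1

theorem Describes.wkSet (h : Describes C Γ) : Describes C.pushSet fun p => Γ p.1 := fun p => h p.1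

theorem Describes.len_eq (h : Describes C Γ) (t : T) :
    C.len t = (Γ t).quota + 1 + ((Γ t).n + 1) * ((Γ t).n + 1) := by
  rw [Ctx.len, h, length_encode]

theorem Describes.order_lt (h : Describes C Γ) (t : T) : (Γ t).n + 1 < C.len t := by
  rw [h.len_eq]
  nlinarith

theorem Describes.quota_succ_lt (h : Describes C Γ) (t : T) : (Γ t).quota + 1 < C.len t := by
  rw [h.len_eq]
  nlinarith

theorem defFun_order (h : Describes C Γ) : DefFun C fun t => (Γ t).n + 1 :=
  (DefFun.count_wordIdx DefFun.one).congr fun t _ => by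
    rw [Ctx.len, h, count_order]

theorem defFun_quota (h : Describes C Γ) : DefFun C fun t => (Γ t).quota := by
  have h1 : DefFun C fun t => (Γ t).quota + 1 :=
    (DefFun.count_wordIdx DefFun.zero).congr fun t _ => by rw [Ctx.len, h, count_quota]
  exact (Definable.eq h1.wkNum (DefFun.last.add DefFun.one)
    fun p _ => h.quota_succ_lt p.1).congr fun p _ => by
      change p.2 = (Γ p.1).quota ↔ _
      omega

theorem definable_isPlayer (h : Describes C Γ) (hf : DefFun C f) :
    Definable C fun t => (Γ t).IsPlayer (f t) :=
  (Definable.bit DefFun.one hf).congr fun t _ => by rw [h, bit_player]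

theorem definable_adj (h : Describes C Γ) (hf : DefFun C f) (hg : DefFun C g) :
    Definable C fun t => (Γ t).Adj (f t) (g t) :=
  (Definable.bit (hf.add (DefFun.one.add DefFun.one)) hg).congr fun t _ => by rw [h, bit_adj]

/-- Reachability between natural numbers; the numbers that are not vertices of the graph count as
isolated vertices. -/
def Reach (Γ : MinInfluenceGame) (u v : ℕ) : Prop :=
  u = v ∨ ∃ (hu : u < Γ.n) (hv : v < Γ.n), Γ.graph.Reachable ⟨u, hu⟩ ⟨v, hv⟩

/-- The numbers less than `m` that are reachable from `u` by fewer than `i` edges. -/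
def reachSet (Γ : MinInfluenceGame) (m u : ℕ) : ℕ → Set ℕ
  | 0 => ∅
  | i + 1 => {y | y < m ∧ (y = u ∨ y ∈ reachSet Γ m u i ∨
      ∃ x < m, x ∈ reachSet Γ m u i ∧ Γ.Adj x y)}

theorem reachSet_mono (Γ : MinInfluenceGame) (m u : ℕ) : Monotone (reachSet Γ m u) := by
  refine monotone_nat_of_le_succ fun i y hy => ?_
  refine ⟨?_, Or.inr (Or.inl hy)⟩
  cases i with
  | zero => exact hy.elim
  | succ i => exact hy.1

theorem reach_of_mem_reachSet {Γ : MinInfluenceGame} {m u : ℕ} :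
    ∀ {i y : ℕ}, y ∈ reachSet Γ m u i → Γ.Reach u y := by
  intro i
  induction i with
  | zero => intro y hy; exact hy.elim
  | succ i ih =>
    rintro y ⟨_, rfl | hy | ⟨x, _, hx, hxv, hyv, hxy⟩⟩
    · exact Or.inl rfl
    · exact ih hy
    · rcases ih hx with rfl | ⟨hu, _, h⟩
      · exact Or.inr ⟨hxv, hyv, hxy.reachable⟩
      · exact Or.inr ⟨hu, hyv, h.trans hxy.reachable⟩

theorem mem_reachSet_of_walk {Γ : MinInfluenceGame} {m u : ℕ} (hm : Γ.n ≤ m) {x y : Fin Γ.n}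
    (p : Γ.graph.Walk x y) :
    ∀ i, x.val ∈ reachSet Γ m u i → y.val ∈ reachSet Γ m u (i + p.length) := by
  induction p with
  | nil => intro i hi; exact hi
  | @cons x z y hxz p ih =>
    intro i hi
    rw [SimpleGraph.Walk.length_cons, add_comm p.length, ← add_assoc]
    exact ih (i + 1) ⟨z.isLt.trans_le hm, Or.inr (Or.inr ⟨x, x.isLt.trans_le hm, hi,
      x.isLt, z.isLt, hxz⟩)⟩

theorem mem_reachSet_iff {Γ : MinInfluenceGame} {m u v : ℕ} (hm : Γ.n < m) (hv : v < m) :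
    v ∈ reachSet Γ m u m ↔ Γ.Reach u v := by
  refine ⟨reach_of_mem_reachSet, ?_⟩
  have h1 : ∀ {y}, y = u → y < m → y ∈ reachSet Γ m u 1 := fun h hy => ⟨hy, Or.inl h⟩
  rintro (rfl | ⟨hu, hv', ⟨p⟩⟩)
  · exact reachSet_mono Γ m _ (by omega) (h1 rfl hv)
  -- A walk may be too long, but a path has fewer than `n` edges.
  · have hp : p.toPath.1.length < Γ.n := by
      simpa using p.toPath.2.length_lt
    exact reachSet_mono Γ m u (by omega)
      (mem_reachSet_of_walk hm.le p.toPath.1 1 (h1 rfl (hu.trans hm)))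

/-- A breadth-first search that takes as many steps as the word has positions is exhaustive. -/
theorem definable_reach_num (h : Describes C Γ) :
    Definable C.pushNum.pushNum fun p => (Γ p.1.1).Reach p.1.2 p.2 := by
  refine (Definable.iter (C := C.pushNum.pushNum) (Q := fun p => p.1.2 ∈ p.2)
    (Φ := fun p X _ y => y = p.1.2 ∨ y ∈ X ∨ ∃ x < C.len p.1.1, x ∈ X ∧ (Γ p.1.1).Adj x y)
    (fun p => reachSet (Γ p.1.1) (C.len p.1.1) p.1.2)
    ((Definable.eq_num isNum_last isNum_last.wkNum.wkSet.wkNum.wkNum).or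
      ((Definable.mem_set isSet_last.wkNum.wkNum isNum_last).or
        (Definable.exists_lt (C := C.pushNum.pushNum.pushSet.pushNum.pushNum)
          (P := fun q => q.2 ∈ q.1.1.1.2 ∧ (Γ q.1.1.1.1.1.1).Adj q.2 q.1.2) ?_)))
    (Definable.mem_set isSet_last isNum_last.wkSet) (fun _ => rfl)
    (fun _ _ _ _ => rfl)).congr ?_
  · exact (Definable.mem_set isSet_last.wkNum.wkNum.wkNum isNum_last).and
      (definable_adj h.wkNum.wkNum.wkSet.wkNum.wkNum.wkNum DefFun.last DefFun.last.wkNum)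
  · rintro p hp
    have := h.order_lt p.1.1
    exact (mem_reachSet_iff (by change _ < C.len p.1.1; omega) hp.2).symm

theorem definable_reach (h : Describes C Γ) (hf : DefFun C f) (hg : DefFun C g)
    (hf' : ∀ t, C.valid t → f t < C.len t) (hg' : ∀ t, C.valid t → g t < C.len t) :
    Definable C fun t => (Γ t).Reach (f t) (g t) :=
  Definable.subst (P := fun p => (Γ p.1).Reach (f p.1) p.2)
    (Definable.subst (C := C.pushNum) (P := fun q => (Γ q.1.1).Reach q.2 q.1.2)
      ((definable_reach_num h).comap
        (((Sub.refl C).wkNum.wkNum.num isNum_last).num isNum_last.wkNum))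
      hf.wkNum fun p hp _ => hf' p.1 hp.1) hg fun t ht _ => hg' t ht

theorem exists_reach (Γ : MinInfluenceGame) (v : ℕ) : ∃ u, Γ.Reach u v := ⟨v, Or.inl rfl⟩

/-- The least vertex of the component of a vertex. -/
noncomputable def root (Γ : MinInfluenceGame) (v : ℕ) : ℕ := Nat.find (Γ.exists_reach v)

theorem root_eq_iff {Γ : MinInfluenceGame} {v t : ℕ} :
    Γ.root v = t ↔ Γ.Reach t v ∧ ∀ u < t, ¬ Γ.Reach u v :=
  Nat.find_eq_iff _

theorem root_le (Γ : MinInfluenceGame) (v : ℕ) : Γ.root v ≤ v := Nat.find_min' _ (Or.inl rfl)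

theorem definable_root_eq (h : Describes C Γ) (hf : DefFun C f) (hg : DefFun C g)
    (hf' : ∀ t, C.valid t → f t < C.len t) (hg' : ∀ t, C.valid t → g t < C.len t) :
    Definable C fun t => (Γ t).root (f t) = g t := by
  refine ((definable_reach h hg hf hg' hf').and (Definable.forall_lt
    (P := fun p => p.2 < g p.1 → ¬ (Γ p.1).Reach p.2 (f p.1)) ?_)).congr fun t ht => ?_
  · refine ((Definable.lt DefFun.last hg.wkNum fun p hp => hg' p.1 hp.1).and (definable_reach
      h.wkNum DefFun.last hf.wkNum (fun _ hp => hp.2) fun p hp => hf' p.1 hp.1)).not.congr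
        fun p _ => by simp
  · rw [root_eq_iff]
    have := hg' t ht
    exact and_congr_right fun _ => ⟨fun h i _ => h i, fun h i hi => h i (hi.trans this) hi⟩

/-- The number of vertices of the component with least vertex `t`. -/
noncomputable def size (Γ : MinInfluenceGame) (t : ℕ) : ℕ :=
  (Finset.univ.filter fun v : Fin Γ.n => Γ.root v = t).card

/-- The number of players in the component with least vertex `t`. -/
noncomputable def playerCount (Γ : MinInfluenceGame) (t : ℕ) : ℕ :=
  (Γ.players.filter fun v : Fin Γ.n => Γ.root v = t).card

theorem card_filter_range {n m : ℕ} (hn : n ≤ m) (P : ℕ → Prop) [DecidablePred fun i => i < n ∧ P i]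
    [DecidablePred fun v : Fin n => P v] :
    ((Finset.range m).filter fun i => i < n ∧ P i).card =
      (Finset.univ.filter fun v : Fin n => P v).card := by
  rw [← Finset.card_map Fin.valEmbedding]
  congr 1
  ext i
  simp only [Finset.mem_filter, Finset.mem_range, Finset.mem_map, Finset.mem_univ, true_and,
    Fin.valEmbedding_apply]
  constructor
  · rintro ⟨-, hi, h⟩
    exact ⟨⟨i, hi⟩, h, rfl⟩
  · rintro ⟨v, h, rfl⟩
    exact ⟨v.isLt.trans_le hn, v.isLt, h⟩

theorem definable_isVertex (h : Describes C Γ) (hf : DefFun C f) :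
    Definable C fun t => f t < (Γ t).n :=
  (Definable.lt (hf.add DefFun.one) (defFun_order h) fun t _ => h.order_lt t).congr
    fun t _ => by omega

theorem defFun_size (h : Describes C Γ) (hf : DefFun C f)
    (hf' : ∀ t, C.valid t → f t < C.len t) : DefFun C fun t => (Γ t).size (f t) := by
  refine (DefFun.count (P := fun p => p.2 < (Γ p.1).n ∧ (Γ p.1).root p.2 = f p.1)
    ((definable_isVertex h.wkNum DefFun.last).and (definable_root_eq h.wkNum DefFun.last hf.wkNum
      (fun _ hp => hp.2) fun p hp => hf' p.1 hp.1))).congr fun t _ => ?_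
  have hn : (Γ t).n ≤ C.len t := (Nat.le_succ _).trans (h.order_lt t).le
  exact (card_filter_range hn fun i => (Γ t).root i = f t).symm

theorem defFun_playerCount (h : Describes C Γ) (hf : DefFun C f)
    (hf' : ∀ t, C.valid t → f t < C.len t) : DefFun C fun t => (Γ t).playerCount (f t) := by
  refine (DefFun.count (P := fun p => p.2 < (Γ p.1).n ∧ ((Γ p.1).IsPlayer p.2 ∧
    (Γ p.1).root p.2 = f p.1))
    ((definable_isVertex h.wkNum DefFun.last).and ((definable_isPlayer h.wkNum DefFun.last).and
      (definable_root_eq h.wkNum DefFun.last hf.wkNum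
        (fun _ hp => hp.2) fun p hp => hf' p.1 hp.1)))).congr fun t _ => ?_
  have hn : (Γ t).n ≤ C.len t := (Nat.le_succ _).trans (h.order_lt t).le
  refine Eq.trans ?_ (card_filter_range hn fun i =>
    (Γ t).IsPlayer i ∧ (Γ t).root i = f t).symm
  rw [playerCount]
  refine congrArg Finset.card (Finset.ext fun v => ?_)
  simp [IsPlayer]

end MinInfluenceGame

end Games

end InfluenceSpread

/-! ### Teams and their spread of influence -/

namespace InfluenceSpread

section Profiles

open scoped Classical
open Ctx

namespace MinInfluenceGame

variable (Γ : MinInfluenceGame)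

theorem Reach.symm {Γ : MinInfluenceGame} {u v : ℕ} (h : Γ.Reach u v) : Γ.Reach v u := by
  rcases h with rfl | ⟨hu, hv, h⟩
  · exact Or.inl rfl
  · exact Or.inr ⟨hv, hu, h.symm⟩

theorem Reach.trans {Γ : MinInfluenceGame} {u v x : ℕ} (h : Γ.Reach u v) (h' : Γ.Reach v x) :
    Γ.Reach u x := by
  rcases h with rfl | ⟨hu, hv, h⟩
  · exact h'
  · rcases h' with rfl | ⟨_, hx, h'⟩
    · exact Or.inr ⟨hu, hv, h⟩
    · exact Or.inr ⟨hu, hx, h.trans h'⟩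

theorem root_eq_root_iff {u v : Fin Γ.n} : Γ.root u = Γ.root v ↔ Γ.graph.Reachable u v := by
  have hR : Γ.Reach u v ↔ Γ.graph.Reachable u v := by
    constructor
    · rintro (h | ⟨_, _, h⟩)
      · rw [Fin.ext h]
      · exact h
    · intro h
      exact Or.inr ⟨u.isLt, v.isLt, h⟩
  have hu := (root_eq_iff (Γ := Γ) (v := u)).1 rfl
  have hv := (root_eq_iff (Γ := Γ) (v := v)).1 rfl
  rw [← hR]
  constructor
  · intro h
    exact hu.1.symm.trans (h ▸ hv.1)
  · intro h
    rw [root_eq_iff]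
    exact ⟨hv.1.trans h.symm, fun t ht htu => hv.2 t ht (htu.trans h)⟩

theorem mem_next {X : Finset (Fin Γ.n)} {v : Fin Γ.n} : v ∈ Γ.toInfluenceGame.next X ↔
    v ∈ X ∨ ∃ u ∈ X, Γ.graph.Adj u v := by
  have h : Γ.toInfluenceGame.label v ≤
      ∑ u ∈ X with Γ.toInfluenceGame.Edge u v, Γ.toInfluenceGame.weight u v ↔
        ∃ u ∈ X, Γ.graph.Adj u v := by
    change 1 ≤ ∑ u ∈ X with Γ.toInfluenceGame.Edge u v, 1 ↔ _
    rw [← Finset.card_eq_sum_ones, Finset.one_le_card]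
    exact Finset.filter_nonempty_iff
  rw [InfluenceGraph.next, Finset.mem_union, Finset.mem_filter, h]
  simp

/-- The spread of influence of a team consists of the components that meet the team. -/
theorem mem_spread {X : Finset (Fin Γ.n)} {v : Fin Γ.n} : v ∈ Γ.toInfluenceGame.spread X ↔
    ∃ u ∈ X, Γ.root u = Γ.root v := by
  simp only [InfluenceGraph.spread, Finset.mem_filter, Finset.mem_univ, true_and,
    root_eq_root_iff]
  constructor
  · rintro ⟨i, hi⟩
    induction i generalizing v with
    | zero => exact ⟨v, hi, .refl v⟩
    | succ i ih =>
      rcases Γ.mem_next.1 hi with h | ⟨x, hx, hxv⟩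
      · exact ih h
      · obtain ⟨u, hu, hux⟩ := ih hx
        exact ⟨u, hu, hux.trans hxv.reachable⟩
  · rintro ⟨u, hu, ⟨p⟩⟩
    have key : ∀ {x y : Fin Γ.n} (p : Γ.graph.Walk x y) i, x ∈ Γ.toInfluenceGame.stage X i →
        ∃ i, y ∈ Γ.toInfluenceGame.stage X i := by
      intro x y p
      induction p with
      | nil => intro i hi; exact ⟨i, hi⟩
      | @cons x z y hxz p ih =>
        intro i hi
        exact ih (i + 1) (Γ.mem_next.2 (Or.inr ⟨x, hi, hxz⟩))
    exact key p 0 hu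

/-- The number of members of a team in the component with least vertex `t`. -/
noncomputable def teamCount (X : Finset (Fin Γ.n)) (t : ℕ) : ℕ := (X.filter fun v : Fin Γ.n => Γ.root v = t).card

variable {m : ℕ}

theorem sum_teamCount (hm : Γ.n ≤ m) (X : Finset (Fin Γ.n)) :
    ∑ t ∈ Finset.range m, Γ.teamCount X t = X.card :=
  (Finset.card_eq_sum_card_fiberwise (f := fun v : Fin Γ.n => Γ.root v) fun v _ => Finset.mem_coe.2 (Finset.mem_range.2
    ((Γ.root_le v).trans_lt (v.isLt.trans_le hm)))).symm

/-- The numbers below `m` that are not least vertices of components contribute nothing, since no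
member of the team has them as its root. -/
theorem card_spread (hm : Γ.n ≤ m) (X : Finset (Fin Γ.n)) :
    (Γ.toInfluenceGame.spread X).card =
      ∑ t ∈ Finset.range m, if Γ.teamCount X t = 0 then 0 else Γ.size t := by
  rw [← Γ.sum_teamCount hm]
  refine Finset.sum_congr rfl fun t _ => ?_
  split_ifs with h
  · rw [teamCount, Finset.card_eq_zero, Finset.filter_eq_empty_iff] at h ⊢
    rintro v hv rfl
    obtain ⟨u, hu, huv⟩ := Γ.mem_spread.1 hv
    exact h hu huv
  · obtain ⟨u, hu⟩ := Finset.card_ne_zero.1 h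
    rw [Finset.mem_filter] at hu
    refine congrArg Finset.card (Finset.ext fun v => ?_)
    simp only [Finset.mem_filter, Finset.mem_univ, true_and, and_iff_right_iff_imp, mem_spread]
    rintro rfl
    exact ⟨u, hu⟩

/-- The other players miss a component if and only if the team contains all players in it. -/
theorem teamCount_sdiff {X : Finset (Fin Γ.n)} (hX : X ⊆ Γ.players) (t : ℕ) :
    Γ.teamCount (Γ.players \ X) t = 0 ↔ Γ.teamCount X t = Γ.playerCount t := by
  have h : Γ.teamCount (Γ.players \ X) t + Γ.teamCount X t = Γ.playerCount t := by
    rw [teamCount, teamCount, playerCount, ← Finset.card_union_of_disjoint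
      (Finset.disjoint_filter_filter Finset.sdiff_disjoint), ← Finset.filter_union,
      Finset.sdiff_union_of_subset hX]
  omega

theorem teamCount_le {X : Finset (Fin Γ.n)} (hX : X ⊆ Γ.players) (t : ℕ) :
    Γ.teamCount X t ≤ Γ.playerCount t :=
  Finset.card_le_card (Finset.filter_subset_filter _ hX)

/-- The numbers of members of a team in the components can be prescribed freely. -/
theorem exists_teamCount_eq {j : ℕ → ℕ} (hj : ∀ t, j t ≤ Γ.playerCount t) :
    ∃ X ⊆ Γ.players, Γ.teamCount X = j := by
  choose Y hY hYj using fun t => Finset.exists_subset_card_eq (hj t)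
  refine ⟨Γ.players.filter fun v : Fin Γ.n => v ∈ Y (Γ.root v), Finset.filter_subset _ _, funext fun t => ?_⟩
  rw [← hYj t]
  refine congrArg Finset.card (Finset.ext fun v => ?_)
  rw [Finset.mem_filter, Finset.mem_filter]
  constructor
  · rintro ⟨⟨_, h⟩, rfl⟩
    exact h
  · intro h
    obtain ⟨h1, h2⟩ := Finset.mem_filter.1 (hY t h)
    exact ⟨⟨h1, h2 ▸ h⟩, h2⟩

/-- Some team has `k` members and influences `a` vertices. -/
def Profile (k a : ℕ) : Prop :=
  ∃ X ⊆ Γ.players, X.card = k ∧ (Γ.toInfluenceGame.spread X).card = a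

/-- Some team influences `a` vertices, while the other players influence `b` vertices. -/
def SplitProfile (a b : ℕ) : Prop :=
  ∃ X ⊆ Γ.players, (Γ.toInfluenceGame.spread X).card = a ∧
    (Γ.toInfluenceGame.spread (Γ.players \ X)).card = b

theorem profile_iff (hm : Γ.n ≤ m) {k a : ℕ} : Γ.Profile k a ↔
    ∃ j : ℕ → ℕ, (∀ t, j t ≤ Γ.playerCount t) ∧ ∑ t ∈ Finset.range m, j t = k ∧
      (∑ t ∈ Finset.range m, if j t = 0 then 0 else Γ.size t) = a := by
  constructor
  · rintro ⟨X, hX, rfl, rfl⟩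
    exact ⟨Γ.teamCount X, Γ.teamCount_le hX, Γ.sum_teamCount hm X, (Γ.card_spread hm X).symm⟩
  · rintro ⟨j, hj, rfl, rfl⟩
    obtain ⟨X, hX, rfl⟩ := Γ.exists_teamCount_eq hj
    exact ⟨X, hX, (Γ.sum_teamCount hm X).symm, Γ.card_spread hm X⟩

theorem splitProfile_iff (hm : Γ.n ≤ m) {a b : ℕ} : Γ.SplitProfile a b ↔
    ∃ j : ℕ → ℕ, (∀ t, j t ≤ Γ.playerCount t) ∧
      (∑ t ∈ Finset.range m, if j t = 0 then 0 else Γ.size t) = a ∧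
      (∑ t ∈ Finset.range m, if j t = Γ.playerCount t then 0 else Γ.size t) = b := by
  have h : ∀ X ⊆ Γ.players, (Γ.toInfluenceGame.spread (Γ.players \ X)).card =
      ∑ t ∈ Finset.range m, if Γ.teamCount X t = Γ.playerCount t then 0 else Γ.size t := by
    intro X hX
    rw [Γ.card_spread hm]
    simp only [Γ.teamCount_sdiff hX]
  constructor
  · rintro ⟨X, hX, rfl, rfl⟩
    exact ⟨Γ.teamCount X, Γ.teamCount_le hX, (Γ.card_spread hm X).symm, (h X hX).symm⟩
  · rintro ⟨j, hj, rfl, rfl⟩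
    obtain ⟨X, hX, rfl⟩ := Γ.exists_teamCount_eq hj
    exact ⟨X, hX, Γ.card_spread hm X, h X hX⟩

theorem card_le (X : Finset (Fin Γ.n)) : X.card ≤ Γ.n := by
  simpa using X.card_le_univ

theorem playerCount_le (t : ℕ) : Γ.playerCount t ≤ Γ.n := Γ.card_le _

end MinInfluenceGame

namespace MinInfluenceGame

variable {T : Type} {C : Ctx (Option Bool) T} {Γ : T → MinInfluenceGame}

/-- Pairs of sums over the components, encoded as one number, are computed by dynamic
programming. -/
theorem definable_code (h : Describes C Γ) {A B : T → ℕ → ℕ → ℕ}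
    (hA : DefFun C.pushNum.pushNum fun p => A p.1.1 p.1.2 p.2)
    (hB : DefFun C.pushNum.pushNum fun p => B p.1.1 p.1.2 p.2) :
    Definable C.pushNum fun p => ∃ j : ℕ → ℕ, (∀ i, j i ≤ (Γ p.1).playerCount i) ∧
      p.2 = ∑ i ∈ Finset.range (C.len p.1), A p.1 i (j i) +
        ((Γ p.1).n + 1) * ∑ i ∈ Finset.range (C.len p.1), B p.1 i (j i) := by
  refine (Definable.sum_choice (O := fun t i o => ∃ j < C.len t, j ≤ (Γ t).playerCount i ∧
    o = A t i j + ((Γ t).n + 1) * B t i j) ?_).congr ?_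
  · refine Definable.exists_lt (C := C.pushNum.pushNum)
      (P := fun q => q.2 ≤ (Γ q.1.1.1).playerCount q.1.1.2 ∧
        q.1.2 = A q.1.1.1 q.1.1.2 q.2 + ((Γ q.1.1.1).n + 1) * B q.1.1.1 q.1.1.2 q.2) ?_
    have hsub := ((Sub.refl C.pushNum).wkNum.wkNum.num (isNum_last (C := C.pushNum.pushNum)))
    refine Definable.and ?_ ?_
    · exact Definable.le DefFun.last (defFun_playerCount h.wkNum DefFun.last fun _ hp =>
        hp.2).wkNum.wkNum fun _ hp => hp.2
    · refine Definable.eq (DefFun.of_num isNum_last.wkNum) ((hA.comap hsub).add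
        ((defFun_order h.wkNum.wkNum.wkNum).mul (hB.comap hsub) fun p _ => ?_)) fun p hp => hp.1.2
      exact h.order_lt p.1.1.1
  · rintro ⟨t, x⟩ ⟨ht, hx⟩
    constructor
    · rintro ⟨j, hj, hxj⟩
      refine ⟨fun i => A t i (j i) + ((Γ t).n + 1) * B t i (j i), fun i _ => ⟨j i, ?_, hj i, rfl⟩,
        ?_⟩
      · exact ((hj i).trans ((Γ t).playerCount_le i)).trans_lt
          ((Nat.lt_succ_self _).trans (h.order_lt t))
      · rw [Finset.sum_add_distrib, ← Finset.mul_sum]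
        exact hxj
    · rintro ⟨o, ho, hxo⟩
      choose! j hj using ho
      -- The choice `j` is arbitrary outside the range of the sum, so it is replaced by `0` there.
      have hj' : ∀ i < C.len t, (if i < C.len t then j i else 0) = j i := fun i hi => if_pos hi
      refine ⟨fun i => if i < C.len t then j i else 0, fun i => ?_, ?_⟩
      · change (if i < C.len t then j i else 0) ≤ (Γ t).playerCount i
        split_ifs with hi
        · exact (hj i hi).2.1
        · exact Nat.zero_le _
      · rw [Finset.mul_sum, ← Finset.sum_add_distrib]
        refine hxo.trans (Finset.sum_congr rfl fun i hi => ?_)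
        rw [Finset.mem_range] at hi
        simp only [hj' i hi]
        exact (hj i hi).2.2

theorem add_mul_inj {N a b a' b' : ℕ} (ha : a < N) (ha' : a' < N)
    (h : a + N * b = a' + N * b') : a = a' ∧ b = b' := by
  have h1 : a = a' := by
    have := congrArg (· % N) h
    simpa [Nat.add_mul_mod_self_left, Nat.mod_eq_of_lt ha, Nat.mod_eq_of_lt ha'] using this
  subst h1
  exact ⟨rfl, Nat.eq_of_mul_eq_mul_left (Nat.zero_lt_of_lt ha) (Nat.add_left_cancel h)⟩

/-- A relation between pairs of sums over the components is definable if the sums are at most `n`: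
the pair `(a, b)` is recovered from its code `a + (n + 1) * b`, which is less than the length of the
word. -/
theorem definable_pair (h : Describes C Γ) {A B : T → ℕ → ℕ → ℕ}
    (hA : DefFun C.pushNum.pushNum fun p => A p.1.1 p.1.2 p.2)
    (hB : DefFun C.pushNum.pushNum fun p => B p.1.1 p.1.2 p.2) {R : T → ℕ → ℕ → Prop}
    (hR : ∀ t a b, R t a b ↔ ∃ j : ℕ → ℕ, (∀ i, j i ≤ (Γ t).playerCount i) ∧
      ∑ i ∈ Finset.range (C.len t), A t i (j i) = a ∧
      ∑ i ∈ Finset.range (C.len t), B t i (j i) = b)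
    (hle : ∀ t a b, R t a b → a ≤ (Γ t).n ∧ b ≤ (Γ t).n) :
    Definable C.pushNum.pushNum fun p => R p.1.1 p.1.2 p.2 := by
  have hcode : ∀ t x, (∃ j : ℕ → ℕ, (∀ i, j i ≤ (Γ t).playerCount i) ∧
      x = ∑ i ∈ Finset.range (C.len t), A t i (j i) +
        ((Γ t).n + 1) * ∑ i ∈ Finset.range (C.len t), B t i (j i)) ↔
      ∃ a b, R t a b ∧ x = a + ((Γ t).n + 1) * b := by
    intro t x
    constructor
    · rintro ⟨j, hj, rfl⟩
      exact ⟨_, _, (hR t _ _).2 ⟨j, hj, rfl, rfl⟩, rfl⟩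
    · rintro ⟨a, b, hab, rfl⟩
      obtain ⟨j, hj, rfl, rfl⟩ := (hR t _ _).1 hab
      exact ⟨j, hj, rfl⟩
  have h1 : Definable C.pushNum fun p => ∃ a b, R p.1 a b ∧ p.2 = a + ((Γ p.1).n + 1) * b :=
    (definable_code h hA hB).congr fun p _ => (hcode p.1 p.2).symm
  have h2 : Definable C.pushNum.pushNum fun p => ∃ a b, R p.1.1 a b ∧
      p.1.2 + ((Γ p.1.1).n + 1) * p.2 = a + ((Γ p.1.1).n + 1) * b := by
    refine Definable.subst (C := C.pushNum.pushNum)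
      (P := fun q => ∃ a b, R q.1.1.1 a b ∧ q.2 = a + ((Γ q.1.1.1).n + 1) * b)
      (h1.comap ((Sub.refl C).wkNum.wkNum.wkNum.num isNum_last))
      (DefFun.add (DefFun.of_num isNum_last.wkNum) ((defFun_order h.wkNum.wkNum).mul DefFun.last
        fun p _ => h.order_lt p.1.1)) ?_
    rintro p - ⟨a, b, hab, hx⟩
    obtain ⟨ha, hb⟩ := hle _ _ _ hab
    refine hx.trans_lt ?_
    change _ < C.len p.1.1
    rw [h.len_eq]
    change a ≤ (Γ p.1.1).n at ha
    change b ≤ (Γ p.1.1).n at hb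
    change a + ((Γ p.1.1).n + 1) * b < _
    nlinarith
  refine ((Definable.lt (DefFun.of_num isNum_last.wkNum) (defFun_order h.wkNum.wkNum)
    fun p _ => h.order_lt p.1.1).and h2).congr fun p _ => ?_
  constructor
  · intro hp
    exact ⟨Nat.lt_succ_of_le (hle _ _ _ hp).1, _, _, hp, rfl⟩
  · rintro ⟨hlt, a, b, hab, hx⟩
    obtain ⟨h1, h2⟩ := add_mul_inj hlt (Nat.lt_succ_of_le (hle _ _ _ hab).1) hx
    rw [h1, h2]
    exact hab

/-- The size of the component `p.1.2`, if `P` does not forbid it: the contribution of the component to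
the spread of a team with `p.2` members in it. -/
theorem defFun_contribution (h : Describes C Γ) {P : (T × ℕ) × ℕ → Prop} [DecidablePred P]
    (hP : Definable C.pushNum.pushNum P) :
    DefFun C.pushNum.pushNum fun p => if P p then 0 else (Γ p.1.1).size p.1.2 :=
  DefFun.ite hP DefFun.zero (defFun_size h.wkNum DefFun.last fun _ hp => hp.2).wkNum

theorem definable_profile (h : Describes C Γ) :
    Definable C.pushNum.pushNum fun p => (Γ p.1.1).Profile p.1.2 p.2 := by
  refine definable_pair h (A := fun _ _ j => j) (B := fun t i j => if j = 0 then 0 else (Γ t).size i)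
    DefFun.last (defFun_contribution h (P := fun p => p.2 = 0) DefFun.zero)
    (R := fun t a b => (Γ t).Profile a b) (fun t a b => (Γ t).profile_iff ?_) ?_
  · exact (Nat.le_succ _).trans (h.order_lt t).le
  · rintro t _ _ ⟨X, _, rfl, rfl⟩
    exact ⟨(Γ t).card_le _, (Γ t).card_le _⟩

theorem definable_splitProfile (h : Describes C Γ) :
    Definable C.pushNum.pushNum fun p => (Γ p.1.1).SplitProfile p.1.2 p.2 := by
  refine definable_pair h (A := fun t i j => if j = 0 then 0 else (Γ t).size i)
    (B := fun t i j => if j = (Γ t).playerCount i then 0 else (Γ t).size i)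
    (defFun_contribution h (P := fun p => p.2 = 0) DefFun.zero)
    (defFun_contribution h (P := fun p => p.2 = (Γ p.1.1).playerCount p.1.2)
      (defFun_playerCount h.wkNum DefFun.last fun _ hp => hp.2))
    (R := fun t a b => (Γ t).SplitProfile a b) (fun t a b => (Γ t).splitProfile_iff ?_) ?_
  · exact (Nat.le_succ _).trans (h.order_lt t).le
  · rintro t _ _ ⟨X, _, rfl, rfl⟩
    exact ⟨(Γ t).card_le _, (Γ t).card_le _⟩

end MinInfluenceGame

end Profiles

end InfluenceSpread

/-! ### Length, width and the decision problems -/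

namespace InfluenceSpread

section Problems

open scoped Classical
open Ctx

theorem PolyTime.congr_output {α β β' αΓ βΓ : Type} {ea : α → List αΓ} {eb : β → List βΓ}
    {eb' : β' → List βΓ} {f : α → β} {f' : α → β'} (h : PolyTime ea eb f)
    (hf : ∀ a, eb (f a) = eb' (f' a)) : PolyTime ea eb' f' := by
  obtain ⟨M⟩ := h
  exact ⟨{ M with outputsFun := fun a => hf a ▸ M.outputsFun a }⟩

/-- The minimum of a set of numbers as the number of positions `x` below all its elements, which is
the form in which machines that evaluate formulas compute numbers. -/
theorem min'_eq_card_filter {s : Finset ℕ} {m : ℕ} (hs : ∀ k ∈ s, k < m) (h : s.Nonempty) :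
    s.min' h = ((Finset.range m).filter fun x => ∀ k < m, k ≤ x → k ∉ s).card := by
  rw [← Finset.card_range (s.min' h)]
  refine congrArg Finset.card (Finset.ext fun x => ?_)
  rw [Finset.mem_filter, Finset.mem_range, Finset.mem_range]
  constructor
  · intro hx
    exact ⟨hx.trans (hs _ (s.min'_mem h)), fun k _ hkx hk =>
      (hx.trans_le (s.min'_le k hk)).not_ge hkx⟩
  · rintro ⟨-, hx⟩
    by_contra! hlt
    exact hx _ (hs _ (s.min'_mem h)) hlt (s.min'_mem h)

theorem max'_eq_card_filter {s : Finset ℕ} {m : ℕ} (hs : ∀ k ∈ s, k < m) (h : s.Nonempty) :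
    s.max' h = ((Finset.range m).filter fun x => ∃ k < m, x < k ∧ k ∈ s).card := by
  rw [← Finset.card_range (s.max' h)]
  refine congrArg Finset.card (Finset.ext fun x => ?_)
  rw [Finset.mem_filter, Finset.mem_range, Finset.mem_range]
  constructor
  · intro hx
    exact ⟨hx.trans (hs _ (s.max'_mem h)), _, hs _ (s.max'_mem h), hx, s.max'_mem h⟩
  · rintro ⟨-, k, -, hxk, hk⟩
    exact hxk.trans_le (s.le_max' k hk)

namespace MinInfluenceGame

section Combinatorics

variable (Γ : MinInfluenceGame) {X : Finset (Fin Γ.n)} {k m : ℕ}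

theorem mem_winning : X ∈ Γ.simpleGame.winning ↔
    X ⊆ Γ.players ∧ Γ.quota ≤ (Γ.toInfluenceGame.spread X).card := by
  change X ∈ Finset.filter (fun X => Γ.toInfluenceGame.quota ≤ (Γ.toInfluenceGame.spread X).card)
    Γ.toInfluenceGame.players.powerset ↔ _
  rw [Finset.mem_filter, Finset.mem_powerset]
  rfl

theorem mem_losing : X ∈ Γ.simpleGame.losing ↔
    X ⊆ Γ.players ∧ (Γ.toInfluenceGame.spread X).card < Γ.quota := by
  rw [SimpleGame.losing, Finset.mem_sdiff, Finset.mem_powerset, mem_winning]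
  change X ⊆ Γ.players ∧ _ ↔ _
  refine and_congr_right fun h => ?_
  rw [not_and, not_le]
  exact ⟨fun h' => h' h, fun h' _ => h'⟩

theorem mem_image_winning (hm : Γ.n < m) : k ∈ Γ.simpleGame.winning.image Finset.card ↔
    ∃ a < m, Γ.quota ≤ a ∧ Γ.Profile k a := by
  rw [Finset.mem_image]
  constructor
  · rintro ⟨X, hX, rfl⟩
    rw [mem_winning] at hX
    exact ⟨_, (Γ.card_le _).trans_lt hm, hX.2, X, hX.1, rfl, rfl⟩
  · rintro ⟨_, _, hq, X, hX, rfl, rfl⟩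
    exact ⟨X, Γ.mem_winning.2 ⟨hX, hq⟩, rfl⟩

theorem mem_image_losing (hm : Γ.n < m) : k ∈ Γ.simpleGame.losing.image Finset.card ↔
    ∃ a < m, a < Γ.quota ∧ Γ.Profile k a := by
  rw [Finset.mem_image]
  constructor
  · rintro ⟨X, hX, rfl⟩
    rw [mem_losing] at hX
    exact ⟨_, (Γ.card_le _).trans_lt hm, hX.2, X, hX.1, rfl, rfl⟩
  · rintro ⟨_, _, hq, X, hX, rfl, rfl⟩
    exact ⟨X, Γ.mem_losing.2 ⟨hX, hq⟩, rfl⟩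

theorem mem_image_card_lt (hm : Γ.n < m) (s : Finset (Finset (Fin Γ.n))) :
    ∀ k ∈ s.image Finset.card, k < m := by
  intro k hk
  obtain ⟨X, -, rfl⟩ := Finset.mem_image.1 hk
  exact (Γ.card_le X).trans_lt hm

theorem nonempty_iff_exists_card (hm : Γ.n < m) (s : Finset (Finset (Fin Γ.n))) :
    s.Nonempty ↔ ∃ k < m, k ∈ s.image Finset.card := by
  constructor
  · rintro ⟨X, hX⟩
    exact ⟨_, (Γ.card_le X).trans_lt hm, Finset.mem_image_of_mem _ hX⟩
  · rintro ⟨k, -, hk⟩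
    exact (Finset.image_nonempty.1 ⟨k, hk⟩)

theorem length_eq (hm : Γ.n < m) : Γ.simpleGame.length =
    if ∃ k < m, k ∈ Γ.simpleGame.winning.image Finset.card then
      some ((Finset.range m).filter fun x =>
        ∀ k < m, k ≤ x → k ∉ Γ.simpleGame.winning.image Finset.card).card
    else none := by
  rw [SimpleGame.length]
  by_cases h : Γ.simpleGame.winning.Nonempty
  · rw [dif_pos h, if_pos ((Γ.nonempty_iff_exists_card hm _).1 h),
      min'_eq_card_filter (Γ.mem_image_card_lt hm _)]
  · rw [dif_neg h, if_neg (mt (Γ.nonempty_iff_exists_card hm _).2 h)]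

theorem width_eq (hm : Γ.n < m) : Γ.simpleGame.width =
    if ∃ k < m, k ∈ Γ.simpleGame.losing.image Finset.card then
      some ((Finset.range m).filter fun x =>
        ∃ k < m, x < k ∧ k ∈ Γ.simpleGame.losing.image Finset.card).card
    else none := by
  rw [SimpleGame.width]
  by_cases h : Γ.simpleGame.losing.Nonempty
  · rw [dif_pos h, if_pos ((Γ.nonempty_iff_exists_card hm _).1 h),
      max'_eq_card_filter (Γ.mem_image_card_lt hm _)]
  · rw [dif_neg h, if_neg (mt (Γ.nonempty_iff_exists_card hm _).2 h)]

theorem isProper_iff (hm : Γ.n < m) : Γ.simpleGame.IsProper ↔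
    ¬ ∃ a < m, ∃ b < m, Γ.quota ≤ a ∧ Γ.quota ≤ b ∧ Γ.SplitProfile a b := by
  constructor
  · rintro h ⟨_, _, _, _, ha, hb, X, hX, rfl, rfl⟩
    exact (Γ.mem_losing.1 (h X (Γ.mem_winning.2 ⟨hX, ha⟩))).2.not_ge hb
  · intro h X hX
    rw [mem_winning] at hX
    refine Γ.mem_losing.2 ⟨Finset.sdiff_subset, ?_⟩
    by_contra! hb
    exact h ⟨_, (Γ.card_le _).trans_lt hm, _, (Γ.card_le _).trans_lt hm, hX.2, hb, X, hX.1, rfl, rfl⟩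

theorem isStrong_iff (hm : Γ.n < m) : Γ.simpleGame.IsStrong ↔
    ¬ ∃ a < m, ∃ b < m, a < Γ.quota ∧ b < Γ.quota ∧ Γ.SplitProfile a b := by
  constructor
  · rintro h ⟨_, _, _, _, ha, hb, X, hX, rfl, rfl⟩
    exact (Γ.mem_winning.1 (h X (Γ.mem_losing.2 ⟨hX, ha⟩))).2.not_gt hb
  · intro h X hX
    rw [mem_losing] at hX
    refine Γ.mem_winning.2 ⟨Finset.sdiff_subset, ?_⟩
    by_contra! hb
    exact h ⟨_, (Γ.card_le _).trans_lt hm, _, (Γ.card_le _).trans_lt hm, hX.2, hb, X, hX.1, rfl, rfl⟩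

theorem isDecisive_iff :
    Γ.simpleGame.IsDecisive ↔ Γ.simpleGame.IsProper ∧ Γ.simpleGame.IsStrong := by
  have hw : ∀ X ⊆ Γ.players, X ∈ Γ.simpleGame.winning ↔ X ∉ Γ.simpleGame.losing := by
    intro X hX
    rw [mem_winning, mem_losing, not_and, not_lt]
    exact ⟨fun h _ => h.2, fun h => ⟨hX, h hX⟩⟩
  constructor
  · intro h
    refine ⟨fun X hX => (h X (Γ.mem_winning.1 hX).1).1 hX, fun X hX => ?_⟩
    have hX' := (Γ.mem_losing.1 hX).1
    exact (hw _ Finset.sdiff_subset).2 fun h' => (hw X hX').1 ((h X hX').2 h') hX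
  · rintro ⟨h1, h2⟩ X hX
    refine ⟨h1 X, fun h => (hw X hX).2 fun h' => ?_⟩
    exact (hw _ Finset.sdiff_subset).1 (h2 X h') h

end Combinatorics

/-- The context of all descriptions of games, without variables. -/
noncomputable def gameCtx : Ctx (Option Bool) MinInfluenceGame where
  valid _ := True
  word := encode
  depth := 0
  env _ _ := ∅
  env_eq _ _ _ := rfl

theorem describes_gameCtx : Describes gameCtx fun Γ => Γ := fun _ => rfl

theorem order_lt (Γ : MinInfluenceGame) : Γ.n < Γ.encode.length :=
  (Nat.lt_succ_self _).trans (describes_gameCtx.order_lt Γ)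

theorem polyTime_of_definable {f : MinInfluenceGame → Option ℕ} {Q : MinInfluenceGame → Prop}
    {P : MinInfluenceGame × ℕ → Prop} (hQ : Definable gameCtx Q) (hP : Definable gameCtx.pushNum P)
    (hf : ∀ Γ : MinInfluenceGame, f Γ = if Q Γ then
      some ((Finset.range Γ.encode.length).filter fun x => P (Γ, x)).card else none) :
    PolyTime encode encodeOptionNat f := by
  obtain ⟨ψ, hψ⟩ := hQ
  obtain ⟨φ, hφ⟩ := hP
  refine polyTime_of_fml φ ψ fun Γ => ?_
  have h1 : ψ.eval Γ.encode 0 (fun _ => ∅) ↔ Q Γ := hψ Γ trivial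
  have h2 : ∀ x ∈ Finset.range Γ.encode.length,
      (P (Γ, x) ↔ φ.eval Γ.encode 1 (Function.update (fun _ => ∅) 0 {x})) := fun x hx =>
    (hφ (Γ, x) ⟨trivial, Finset.mem_range.1 hx⟩).symm
  rw [hf, Finset.filter_congr h2]
  simp only [h1]

/-- The answers to a decision problem are encoded like the values `some 0` and `none`. -/
theorem inP_of_definable {Q : MinInfluenceGame → Prop} (hQ : Definable gameCtx Q) :
    InP encode Q := by
  -- The formula `Q ∧ ¬ Q` counts no position.
  refine (polyTime_of_definable (f := fun Γ => if Q Γ then some 0 else none) (P := fun p => p.2 < 0)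
    hQ (hQ.wkNum.and hQ.wkNum.not |>.congr fun p _ => by simp) fun Γ => ?_).congr_output fun Γ => ?_
  · simp
  · by_cases h : Q Γ
    · simp [h, encodeOptionNat, Computability.encodeBool, Computability.unaryEncodeNat]
    · simp [h, encodeOptionNat, Computability.encodeBool]

theorem definable_mem_image_winning {T : Type} {C : Ctx (Option Bool) T}
    {Γ : T → MinInfluenceGame} (h : Describes C Γ) :
    Definable C.pushNum fun p => p.2 ∈ (Γ p.1).simpleGame.winning.image Finset.card := by
  refine (Definable.exists_lt (P := fun p => (Γ p.1.1).quota ≤ p.2 ∧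
    (Γ p.1.1).Profile p.1.2 p.2) ?_).congr fun p hp =>
      (Γ p.1).mem_image_winning ((Nat.lt_succ_self _).trans (h.order_lt p.1))
  exact (Definable.le (defFun_quota h.wkNum.wkNum) DefFun.last fun p _ =>
    (Nat.lt_succ_self _).trans (h.quota_succ_lt p.1.1)).and (definable_profile h)

theorem definable_mem_image_losing {T : Type} {C : Ctx (Option Bool) T}
    {Γ : T → MinInfluenceGame} (h : Describes C Γ) :
    Definable C.pushNum fun p => p.2 ∈ (Γ p.1).simpleGame.losing.image Finset.card := by
  refine (Definable.exists_lt (P := fun p => p.2 < (Γ p.1.1).quota ∧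
    (Γ p.1.1).Profile p.1.2 p.2) ?_).congr fun p hp =>
      (Γ p.1).mem_image_losing ((Nat.lt_succ_self _).trans (h.order_lt p.1))
  exact (Definable.lt DefFun.last (defFun_quota h.wkNum.wkNum) fun p _ =>
    (Nat.lt_succ_self _).trans (h.quota_succ_lt p.1.1)).and (definable_profile h)

theorem definable_isProper : Definable gameCtx fun Γ => Γ.simpleGame.IsProper := by
  have h := describes_gameCtx
  refine (Definable.not (Definable.exists_lt (P := fun p => ∃ b < gameCtx.len p.1,
    p.1.quota ≤ p.2 ∧ p.1.quota ≤ b ∧ p.1.SplitProfile p.2 b) (Definable.exists_lt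
      (C := gameCtx.pushNum)
      (P := fun p => p.1.1.quota ≤ p.1.2 ∧ p.1.1.quota ≤ p.2 ∧ p.1.1.SplitProfile p.1.2 p.2)
      ?_))).congr fun Γ _ => Γ.isProper_iff Γ.order_lt
  have hq := defFun_quota h.wkNum.wkNum
  have hlt : ∀ p : (MinInfluenceGame × ℕ) × ℕ, p.1.1.quota < gameCtx.len p.1.1 := fun p =>
    (Nat.lt_succ_self _).trans (h.quota_succ_lt p.1.1)
  exact (Definable.le hq (DefFun.of_num isNum_last.wkNum) fun p _ => hlt p).and
    ((Definable.le hq DefFun.last fun p _ => hlt p).and (definable_splitProfile h))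

theorem definable_isStrong : Definable gameCtx fun Γ => Γ.simpleGame.IsStrong := by
  have h := describes_gameCtx
  refine (Definable.not (Definable.exists_lt (P := fun p => ∃ b < gameCtx.len p.1,
    p.2 < p.1.quota ∧ b < p.1.quota ∧ p.1.SplitProfile p.2 b) (Definable.exists_lt
      (C := gameCtx.pushNum)
      (P := fun p => p.1.2 < p.1.1.quota ∧ p.2 < p.1.1.quota ∧ p.1.1.SplitProfile p.1.2 p.2)
      ?_))).congr fun Γ _ => Γ.isStrong_iff Γ.order_lt
  have hq := defFun_quota h.wkNum.wkNum
  have hlt : ∀ p : (MinInfluenceGame × ℕ) × ℕ, p.1.1.quota < gameCtx.len p.1.1 := fun p =>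
    (Nat.lt_succ_self _).trans (h.quota_succ_lt p.1.1)
  exact (Definable.lt (DefFun.of_num isNum_last.wkNum) hq fun p _ => hlt p).and
    ((Definable.lt DefFun.last hq fun p _ => hlt p).and (definable_splitProfile h))

theorem polyTime_length : PolyTime encode encodeOptionNat fun Γ => Γ.simpleGame.length := by
  have h := definable_mem_image_winning describes_gameCtx
  refine polyTime_of_definable (Definable.exists_lt h) (Definable.forall_lt
    (C := gameCtx.pushNum)
    (P := fun p => p.2 ≤ p.1.2 → p.2 ∉ p.1.1.simpleGame.winning.image Finset.card) ?_)
    fun Γ => by convert Γ.length_eq Γ.order_lt <;> rfl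
  have hle : Definable gameCtx.pushNum.pushNum fun p => p.2 ≤ p.1.2 :=
    Definable.le DefFun.last (DefFun.of_num isNum_last.wkNum) fun p hp => hp.2
  exact (hle.nand (h.comap ((Sub.refl gameCtx).wkNum.wkNum.num isNum_last))).congr
    fun p _ => not_and.symm

theorem polyTime_width : PolyTime encode encodeOptionNat fun Γ => Γ.simpleGame.width := by
  have h := definable_mem_image_losing describes_gameCtx
  refine polyTime_of_definable (Definable.exists_lt h) (Definable.exists_lt
    (C := gameCtx.pushNum)
    (P := fun p => p.1.2 < p.2 ∧ p.2 ∈ p.1.1.simpleGame.losing.image Finset.card) ?_)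
    fun Γ => by convert Γ.width_eq Γ.order_lt <;> rfl
  exact (Definable.lt_num isNum_last.wkNum isNum_last).and
    (h.comap ((Sub.refl gameCtx).wkNum.wkNum.num isNum_last))

end MinInfluenceGame

end Problems

end InfluenceSpread

theorem mainTheorem11 :
    InfluenceSpread.PolyTime InfluenceSpread.MinInfluenceGame.encode
        InfluenceSpread.encodeOptionNat (fun Γ => Γ.simpleGame.length) ∧
      InfluenceSpread.PolyTime InfluenceSpread.MinInfluenceGame.encode
        InfluenceSpread.encodeOptionNat (fun Γ => Γ.simpleGame.width) ∧
      InfluenceSpread.InP InfluenceSpread.MinInfluenceGame.encode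
        (fun Γ => Γ.simpleGame.IsProper) ∧
      InfluenceSpread.InP InfluenceSpread.MinInfluenceGame.encode
        (fun Γ => Γ.simpleGame.IsStrong) ∧
      InfluenceSpread.InP InfluenceSpread.MinInfluenceGame.encode
        (fun Γ => Γ.simpleGame.IsDecisive) := by
  open InfluenceSpread MinInfluenceGame in
  exact ⟨polyTime_length, polyTime_width, inP_of_definable definable_isProper,
    inP_of_definable definable_isStrong, inP_of_definable
      ((definable_isProper.and definable_isStrong).congr fun Γ _ => Γ.isDecisive_iff)⟩
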